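/- An \emph{mm-space} is a complete separable metric space $(X,d)$ of diameter at most $1$ with a Borel probability measure $\mu$ of full support. Let $M_\infty$ be the compact space of infinite matrices $(d_{i,j})_{i,j\ge 1}$ with $0\le d_{i,j}\le 1$, $d_{i,j}=d_{j,i}$, $d_{i,i}=0$, with the topology of entrywise convergence, and let $\mathcal P(M_\infty)$ be the space of Borel probability measures on $M_\infty$ with the weak topology. The sampling measure $\tau(X)\in\mathcal P(M_\infty)$ of an mm-space $X$ is the law of $(d(x_i,x_j))_{i,j}$, where $x_1,x_2,\dots$ are independent $\mu$-random points. The sampling compactification $\overline\chi$ is the closure in $\mathcal P(M_\infty)$ of the set of the measures $\tau(X)$ of all mm-spaces $X$. A \emph{quantum metric measure space} (qmm-space) is a triple $(X,\mu,d^*)$, where $X$ is a standard Borel space, $\mu$ is a probability measure on $X$, and $d^*:X\times X\to\mathcal P[0,1]$ is a Borel measurable map into the space of probability measures on $[0,1]$ such that $d^*(x,x)=\delta_0$ and $d^*(x,y)=d^*(y,x)$ for all $x,y\in X$, and such that for $\mu^3$-almost every triple $(a,b,c)\in X^3$, independent random lengths $l(a,b)$, $l(b,c)$, $l(a,c)$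 with laws $d^*(a,b)$, $d^*(b,c)$, $d^*(a,c)$ almost surely satisfy the triangle inequalities (each is at most the sum of the other two). Its sampling measure $\tau(X)\in\mathcal P(M_\infty)$ is obtained as follows. A symmetric matrix $s=(s_{i,j})$ with entries in $\mathcal P[0,1]$ and $s_{i,i}=\delta_0$ defines the law on $M_\infty$ of the random symmetric matrix whose entries above the diagonal are independent, the $(i,j)$ entry having law $s_{i,j}$; then $\tau(X)$ is the barycenter (mixture) of the laws defined by $(d^*(x_i,x_j))_{i,j}$, where $x_1,x_2,\dots$ are independent $\mu$-random points. \textbf{Theorem.} For every $\kappa\in\overline\chi$ there is a qmm-space $X$ with $\tau(X)=\kappa$. Conversely, $\tau(X)\in\overline\chi$ for every qmm-space $X$. -/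

import Mathlib

open MeasureTheory Set Topology

universe u

/-- The space `M_∞` of infinite symmetric matrices with entries in `[0,1]` and zero diagonal, with
the topology of entrywise convergence (rows and columns are indexed by `0, 1, 2, …`). -/
abbrev MInfty : Type :=
  {d : ℕ → ℕ → unitInterval // (∀ i j, d i j = d j i) ∧ ∀ i, d i i = 0}

/-- A metric measure space: a complete separable metric space of diameter at most one with
a Borel probability measure of full support. Such a space has at most continuum many points, so
carriers in `Type` give all of them up to isomorphism. -/
structure MMSpace where
  carrier : Type
  [metric : MetricSpace carrier]
  [complete : CompleteSpace carrier]
  [separable : TopologicalSpace.SeparableSpace carrier]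
  [meas : MeasurableSpace carrier]
  [borel : BorelSpace carrier]
  dist_le_one : ∀ x y : carrier, dist x y ≤ 1
  μ : Measure carrier
  [prob : IsProbabilityMeasure μ]
  [fullSupport : μ.IsOpenPosMeasure]

namespace MMSpace

attribute [instance] metric complete separable meas borel prob fullSupport

/-- The map `ρ : X^ℕ → M_∞`, `(x_i) ↦ (d(x_i, x_j))`. -/
def rho (X : MMSpace) (x : ℕ → X.carrier) : MInfty :=
  ⟨fun i j => ⟨dist (x i) (x j), mem_Icc.2 ⟨dist_nonneg, X.dist_le_one _ _⟩⟩,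
    fun i j => Subtype.ext (dist_comm (x i) (x j)), fun i => Subtype.ext (dist_self (x i))⟩

theorem measurable_rho (X : MMSpace) : Measurable X.rho := by
  have : SecondCountableTopology X.carrier := UniformSpace.secondCountable_of_separable _
  refine Measurable.subtype_mk (measurable_pi_lambda _ fun i => measurable_pi_lambda _ fun j => ?_)
  exact Measurable.subtype_mk ((measurable_pi_apply i).dist (measurable_pi_apply j))

/-- The sampling measure `τ(X)`: the push-forward of `μ × μ × ⋯` by `ρ`. -/
noncomputable def tau (X : MMSpace) : ProbabilityMeasure MInfty :=
  ⟨(Measure.infinitePi fun _ : ℕ => X.μ).map X.rho,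
    Measure.isProbabilityMeasure_map X.measurable_rho.aemeasurable⟩

end MMSpace

/-- The sampling compactification of the set of mm-spaces: the closure of the set of their sampling
measures in the space of probability measures on `M_∞` with the weak topology. -/
def chiBar : Set (ProbabilityMeasure MInfty) :=
  closure (range MMSpace.tau)

/-- The point mass at `0`, as an element of `𝒫[0,1]`. -/
noncomputable def diracZero : ProbabilityMeasure unitInterval :=
  ⟨Measure.dirac 0, inferInstance⟩

/-- Quantum metric measure spaces. The `σ`-algebra on `𝒫[0,1]` is the one generated by the
evaluations at Borel sets, which is the Borel `σ`-algebra of the weak topology. -/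
structure QMMSpace where
  carrier : Type u
  [meas : MeasurableSpace carrier]
  [standardBorel : StandardBorelSpace carrier]
  μ : Measure carrier
  [prob : IsProbabilityMeasure μ]
  d : carrier → carrier → ProbabilityMeasure unitInterval
  measurable_d : Measurable (Function.uncurry d)
  d_self : ∀ x, d x x = diracZero
  d_comm : ∀ x y, d x y = d y x
  /-- For almost all triples `(a, b, c)`, independent lengths `l(a,b)`, `l(b,c)`, `l(a,c)` with laws
  `d a b`, `d b c`, `d a c` almost surely satisfy the triangle inequalities. -/
  triangle : ∀ᵐ t : carrier × carrier × carrier ∂(μ.prod (μ.prod μ)),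
    ∀ᵐ l : unitInterval × unitInterval × unitInterval
      ∂((d t.1 t.2.1 : Measure unitInterval).prod
        ((d t.2.1 t.2.2 : Measure unitInterval).prod (d t.1 t.2.2 : Measure unitInterval))),
      (l.1 : ℝ) ≤ l.2.1 + l.2.2 ∧ (l.2.1 : ℝ) ≤ l.1 + l.2.2 ∧ (l.2.2 : ℝ) ≤ l.1 + l.2.1

/-- The space `M̂_∞` of infinite symmetric matrices with entries in `𝒫[0,1]` and with the point mass
at zero on the diagonal. -/
abbrev MHatInfty : Type :=
  {s : ℕ → ℕ → ProbabilityMeasure unitInterval // (∀ i j, s i j = s j i) ∧ ∀ i, s i i = diracZero}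

/-- The positions above the diagonal. -/
abbrev UpperPair : Type := {p : ℕ × ℕ // p.1 < p.2}

/-- The symmetric matrix with zero diagonal that has the given entries above the diagonal. -/
def symmFill (e : UpperPair → unitInterval) : MInfty :=
  ⟨fun i j => if h : i < j then e ⟨(i, j), h⟩ else if h : j < i then e ⟨(j, i), h⟩ else 0, by
    intro i j
    rcases lt_trichotomy i j with h | h | h
    · simp [h, h.not_gt]
    · simp [h]
    · simp [h, h.not_gt], by
    intro i
    simp⟩

theorem measurable_symmFill : Measurable symmFill := by
  refine Measurable.subtype_mk (measurable_pi_lambda _ fun i => measurable_pi_lambda _ fun j => ?_)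
  by_cases h : i < j
  · simpa [h] using measurable_pi_apply (X := fun _ : UpperPair => unitInterval) ⟨(i, j), h⟩
  · by_cases h' : j < i
    · simpa [h, h'] using measurable_pi_apply (X := fun _ : UpperPair => unitInterval) ⟨(j, i), h'⟩
    · simp [h, h']

/-- The probability measure on `M_∞` defined by `s ∈ M̂_∞`: the law of the random symmetric matrix
whose entries above the diagonal are independent, the `(i,j)` entry having law `s i j`. -/
noncomputable def matrixLaw (s : MHatInfty) : ProbabilityMeasure MInfty :=
  ⟨(Measure.infinitePi fun p : UpperPair => (s.1 p.1.1 p.1.2 : Measure unitInterval)).map symmFill,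
    Measure.isProbabilityMeasure_map measurable_symmFill.aemeasurable⟩

theorem measurable_matrixLaw : Measurable matrixLaw := by
  refine Measurable.subtype_mk ((Measure.measurable_map _ measurable_symmFill).comp ?_)
  refine Measurable.measure_of_isPiSystem_of_isProbabilityMeasure
    (generateFrom_squareCylinders (α := fun _ : UpperPair => unitInterval)).symm
    (isPiSystem_squareCylinders (fun _ => MeasurableSpace.isPiSystem_measurableSet)
      (fun _ => mem_ofPred.2 MeasurableSet.univ)) ?_
  intro t ht
  obtain ⟨F, S, hS, rfl⟩ := ht
  have hS' : ∀ i, MeasurableSet (S i) := fun i => hS i (mem_univ i)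
  have h : ∀ s : MHatInfty,
      (Measure.infinitePi fun p : UpperPair => (s.1 p.1.1 p.1.2 : Measure unitInterval))
        ((F : Set UpperPair).pi S)
      = ∏ p ∈ F, (s.1 p.1.1 p.1.2 : Measure unitInterval) (S p) :=
    fun s => Measure.infinitePi_pi _ (fun i _ => hS' i)
  simp only [h]
  refine Finset.measurable_prod _ fun p _ => ?_
  exact (Measure.measurable_coe (hS' p)).comp (measurable_subtype_coe.comp
    ((measurable_pi_apply p.1.2).comp ((measurable_pi_apply p.1.1).comp measurable_subtype_coe)))

/-- The barycenter of a probability measure `P` on the space of probability measures on `Ω`: the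
mixture `A ↦ ∫ m(A) dP(m)`. -/
noncomputable def barycenter {Ω : Type*} [MeasurableSpace Ω]
    (P : ProbabilityMeasure (ProbabilityMeasure Ω)) : ProbabilityMeasure Ω :=
  ⟨(P : Measure (ProbabilityMeasure Ω)).bind fun m => (m : Measure Ω), by
    constructor
    have h : Measurable fun m : ProbabilityMeasure Ω => (m : Measure Ω) := measurable_subtype_coe
    rw [Measure.bind_apply MeasurableSet.univ h.aemeasurable]
    simp⟩

namespace QMMSpace

attribute [instance] meas standardBorel prob

/-- The map `X^ℕ → M̂_∞`, `(x_i) ↦ (d^*(x_i, x_j))`. -/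
def rhoHat (X : QMMSpace.{u}) (x : ℕ → X.carrier) : MHatInfty :=
  ⟨fun i j => X.d (x i) (x j), fun _ _ => X.d_comm _ _, fun _ => X.d_self _⟩

theorem measurable_rhoHat (X : QMMSpace.{u}) : Measurable X.rhoHat := by
  refine Measurable.subtype_mk (measurable_pi_lambda _ fun i => measurable_pi_lambda _ fun j => ?_)
  exact X.measurable_d.comp
    ((measurable_pi_apply (X := fun _ : ℕ => X.carrier) i).prodMk (measurable_pi_apply j))

/-- The sampling measure `τ(X)`: push `μ × μ × ⋯` forward to `M̂_∞`, view it as a probability measure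
on the space of probability measures on `M_∞`, and take its barycenter. -/
noncomputable def tau (X : QMMSpace.{u}) : ProbabilityMeasure MInfty :=
  barycenter ⟨((Measure.infinitePi fun _ : ℕ => X.μ).map X.rhoHat).map matrixLaw, by
    have := Measure.isProbabilityMeasure_map
      (μ := Measure.infinitePi fun _ : ℕ => X.μ) X.measurable_rhoHat.aemeasurable
    exact Measure.isProbabilityMeasure_map measurable_matrixLaw.aemeasurable⟩

end QMMSpace

/-! Both the compactification and the set of sampling measures of qmm-spaces coincide with one
explicit set, `IsExchangeableDissociated`: laws of random semimetrics on the naturals that are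
invariant under injective reindexing, whose even and odd blocks are independent, and which satisfy
the triangle inequality almost surely.

Sampling measures of mm-spaces have these properties, and the properties pass to weak limits
(`isClosed_isExchangeableDissociated`). Sampling measures of qmm-spaces have them as well
(`QMMSpace.isExchangeableDissociated_tau`). Two converses remain.

Approximation by mm-spaces (`mem_chiBar`): a matrix drawn from `κ` is a semimetric on the naturals.
Distribute mass over its points by the cells of a Gaussian label and complete. As the cells shrink,
finitely many labels lie in distinct cells, so the mean of a test function under the resulting
sampling measure tends on average to its `κ`-integral; dissociation gives the second moment, and the
variance tends to zero. Hence some matrix is good for finitely many test functions at once.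

Representation by a qmm-space (`exists_qmmSpace`), an Aldous–Hoover argument: split the indices
modulo 3 into sample points and two kinds of reference points. Exchangeability shows that, given the
reference matrix, the rows of distances from sample points to references of the first kind are
i.i.d., and that, given these too, the lengths between sample points are independent with laws
depending on the two rows only. The engine is `lintegral_mul_indicator_of_map_eq`: enlarging the
conditioning variable without changing its joint law with the target adds no information. By
dissociation the sample is independent of the references, so one reference matrix can be fixed;
points of the qmm-space are then rows, with a diffuse label added so that the diagonal can be set to
the point mass at zero. -/

open ProbabilityTheory Filter

open scoped BoundedContinuousFunction

/-! ### Infinite product measures -/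

namespace MeasureTheory.Measure

section InfiniteProducts

variable {α ι ι₁ ι₂ : Type*} [MeasurableSpace α]

/-- An infinite product over a sum type is the product of the two infinite products. -/
theorem infinitePi_map_sumElim {X : Type*} [MeasurableSpace X] (μ : ι₁ ⊕ ι₂ → Measure X)
    [∀ i, IsProbabilityMeasure (μ i)] :
    (infinitePi μ).map (fun x => (fun i => x (Sum.inl i), fun i => x (Sum.inr i)))
      = (infinitePi fun i => μ (Sum.inl i)).prod (infinitePi fun i => μ (Sum.inr i)) := by
  classical
  let merge : (ι₁ → X) × (ι₂ → X) → ι₁ ⊕ ι₂ → X := fun p => Sum.elim p.1 p.2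
  have hm : Measurable merge := by
    refine measurable_pi_lambda _ fun i => ?_
    rcases i with i | i
    · exact (measurable_pi_apply i).comp measurable_fst
    · exact (measurable_pi_apply i).comp measurable_snd
  have h : ((infinitePi fun i => μ (Sum.inl i)).prod (infinitePi fun i => μ (Sum.inr i))).map merge
      = infinitePi μ := by
    refine eq_infinitePi μ fun s t ht => ?_
    rw [map_apply hm (.pi s.countable_toSet fun i _ => ht i)]
    have : merge ⁻¹' ((s : Set (ι₁ ⊕ ι₂)).pi t)
        = ((s.toLeft : Set ι₁).pi fun i => t (Sum.inl i)) ×ˢ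
          ((s.toRight : Set ι₂).pi fun i => t (Sum.inr i)) := by
      ext p
      simp [merge, Set.mem_pi]
    rw [this, prod_prod, infinitePi_pi _ (fun i _ => ht _), infinitePi_pi _ (fun i _ => ht _)]
    conv_rhs => rw [← s.toLeft_disjSum_toRight, Finset.prod_disjSum]
  rw [← h, map_map (by fun_prop) hm]
  exact map_id

/-- Coordinates of an infinite product over two disjoint index sets are independent. -/
theorem infinitePi_map_pair_of_injective {X : Type*} [MeasurableSpace X] (μ : ι → Measure X)
    [∀ i, IsProbabilityMeasure (μ i)] {σ : ι₁ → ι} {τ : ι₂ → ι} (hσ : Function.Injective σ)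
    (hτ : Function.Injective τ) (hστ : ∀ i j, σ i ≠ τ j) :
    (infinitePi μ).map (fun x => (fun i => x (σ i), fun i => x (τ i)))
      = (infinitePi fun i => μ (σ i)).prod (infinitePi fun i => μ (τ i)) := by
  have hinj : Function.Injective (Sum.elim σ τ) := hσ.sumElim hτ hστ
  have h := map_infinitePi_infinitePi_of_inj (P := μ) hinj
  have h2 := infinitePi_map_sumElim (fun i => μ (Sum.elim σ τ i))
  rw [← h, map_map (by fun_prop) (by fun_prop)] at h2
  exact h2

/-- An infinite product depends measurably on its factors. -/
theorem measurable_infinitePi {X : ι → Type*} [∀ i, MeasurableSpace (X i)]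
    {k : ∀ i, α → Measure (X i)} [∀ i a, IsProbabilityMeasure (k i a)]
    (hk : ∀ i, Measurable (k i)) :
    Measurable fun a => infinitePi fun i => k i a := by
  refine Measurable.measure_of_isPiSystem_of_isProbabilityMeasure
    (generateFrom_squareCylinders (α := X)).symm
    (isPiSystem_squareCylinders (fun _ => MeasurableSpace.isPiSystem_measurableSet)
      (fun _ => mem_ofPred.2 MeasurableSet.univ)) ?_
  intro t ht
  obtain ⟨F, S, hS, rfl⟩ := ht
  have hS' : ∀ i, MeasurableSet (S i) := fun i => hS i (mem_univ i)
  have h : ∀ a, (infinitePi fun i => k i a) ((F : Set ι).pi S) = ∏ i ∈ F, k i a (S i) :=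
    fun a => infinitePi_pi _ fun i _ => hS' i
  simp only [h]
  exact Finset.measurable_prod _ fun i _ => (measurable_coe (hS' i)).comp (hk i)

/-- Almost every sample from a diffuse distribution has no repetitions. -/
theorem ae_injective_infinitePi {X : Type*} [MeasurableSpace X] [MeasurableEq X]
    (μ : Measure X) [IsProbabilityMeasure μ] [NullSingletonClass μ] :
    ∀ᵐ x ∂(infinitePi fun _ : ℕ => μ), Function.Injective x := by
  have h : ∀ i j : ℕ, ∀ᵐ x ∂(infinitePi fun _ : ℕ => μ), x i = x j → i = j := by
    intro i j
    rcases eq_or_ne i j with hij | hij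
    · exact .of_forall fun _ _ => hij
    have h1 : ∀ᵐ p ∂μ.prod μ, p.1 ≠ p.2 := by
      rw [ae_prod_iff_ae_ae (p := fun p : X × X => p.1 ≠ p.2)
        (measurableSet_eq_fun measurable_fst measurable_snd).compl]
      refine .of_forall fun x => ?_
      filter_upwards [compl_mem_ae_iff.2 (measure_singleton (μ := μ) x)] with y hy using Ne.symm hy
    rw [← infinitePi_map_eval_prod (P := fun _ : ℕ => μ) hij] at h1
    filter_upwards [ae_of_ae_map (by fun_prop) h1] with x hx h using absurd h hx
  filter_upwards [ae_all_iff.2 fun i => ae_all_iff.2 (h i)] with x hx i j using hx i j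

end InfiniteProducts

end MeasureTheory.Measure

/-! ### Product kernels and conditional independence -/

namespace ProbabilityTheory

open Measure

/-- The product of a family of Markov kernels. -/
noncomputable def Kernel.infinitePi {α ι : Type*} [MeasurableSpace α] {X : ι → Type*}
    [∀ i, MeasurableSpace (X i)] (k : ∀ i, Kernel α (X i)) [∀ i, IsMarkovKernel (k i)] :
    Kernel α (∀ i, X i) where
  toFun a := Measure.infinitePi fun i => k i a
  measurable' := measurable_infinitePi fun i => (k i).measurable

theorem Kernel.infinitePi_apply {α ι : Type*} [MeasurableSpace α] {X : ι → Type*}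
    [∀ i, MeasurableSpace (X i)] (k : ∀ i, Kernel α (X i)) [∀ i, IsMarkovKernel (k i)] (a : α) :
    Kernel.infinitePi k a = Measure.infinitePi fun i => k i a := rfl

instance {α ι : Type*} [MeasurableSpace α] {X : ι → Type*}
    [∀ i, MeasurableSpace (X i)] (k : ∀ i, Kernel α (X i)) [∀ i, IsMarkovKernel (k i)] :
    IsMarkovKernel (Kernel.infinitePi k) :=
  ⟨fun a => by rw [Kernel.infinitePi_apply]; infer_instance⟩

section ConditionalIndependence

variable {Ω V Y : Type*} [MeasurableSpace Ω] [MeasurableSpace V] [MeasurableSpace Y]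
  {P : Measure Ω} [IsProbabilityMeasure P]

theorem lintegral_mul_indicator_of_map_eq_compProd {η : Ω → V} {ξ : Ω → Y} {k : Kernel V Y}
    [IsMarkovKernel k] (hη : Measurable η) (hξ : Measurable ξ)
    (hk : P.map (fun ω => (η ω, ξ ω)) = P.map η ⊗ₘ k) {w : V → ENNReal} (hw : Measurable w)
    {S : Set Y} (hS : MeasurableSet S) :
    ∫⁻ ω, w (η ω) * S.indicator 1 (ξ ω) ∂P = ∫⁻ ω, w (η ω) * k (η ω) S ∂P := by
  have hi : Measurable (S.indicator (1 : Y → ENNReal)) := measurable_one.indicator hS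
  have h1 : ∫⁻ ω, w (η ω) * S.indicator 1 (ξ ω) ∂P
      = ∫⁻ p, w p.1 * S.indicator 1 p.2 ∂(P.map fun ω => (η ω, ξ ω)) := by
    rw [lintegral_map (by fun_prop) (by fun_prop)]
  rw [h1, hk, Measure.lintegral_compProd (by fun_prop), lintegral_map (by fun_prop) hη]
  refine lintegral_congr fun ω => ?_
  dsimp only
  rw [lintegral_const_mul _ hi, lintegral_indicator_one hS]

/-- If `(η, ξ)` and `(η', ξ)` have the same law and `η` is a function of `η'`, then `η'` carries no
more information about `ξ` than `η`. -/
theorem lintegral_mul_indicator_of_map_eq {η η' : Ω → V} {ξ : Ω → Y} {k : Kernel V Y}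
    [IsMarkovKernel k] (hη : Measurable η) (hη' : Measurable η') (hξ : Measurable ξ)
    (hk : P.map (fun ω => (η ω, ξ ω)) = P.map η ⊗ₘ k)
    (hlaw : P.map (fun ω => (η' ω, ξ ω)) = P.map (fun ω => (η ω, ξ ω)))
    (hsub : Measurable[MeasurableSpace.comap η' inferInstance] η)
    {W : Ω → ENNReal} (hW : Measurable[MeasurableSpace.comap η' inferInstance] W)
    {S : Set Y} (hS : MeasurableSet S) :
    ∫⁻ ω, W ω * S.indicator 1 (ξ ω) ∂P = ∫⁻ ω, W ω * k (η ω) S ∂P := by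
  have hlaw1 : P.map η' = P.map η := by
    have := congrArg (Measure.map Prod.fst) hlaw
    rwa [map_map measurable_fst (by fun_prop), map_map measurable_fst (by fun_prop)] at this
  have hk' : P.map (fun ω => (η' ω, ξ ω)) = P.map η' ⊗ₘ k := by rw [hlaw, hk, hlaw1]
  have hkS : Measurable fun v => k v S := k.measurable_coe hS
  obtain ⟨w, hw, rfl⟩ := hW.exists_eq_measurable_comp
  have hp : Measurable fun ω => k (η ω) S := hkS.comp hη
  have hp' : Measurable fun ω => k (η' ω) S := hkS.comp hη'
  have hsubp : Measurable[MeasurableSpace.comap η' inferInstance] fun ω => k (η ω) S :=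
    hkS.comp hsub
  obtain ⟨r, hr, hrp⟩ := hsubp.exists_eq_measurable_comp
  have hle : ∀ v, k v S ≤ 1 := fun v => prob_le_one
  -- the second moments agree, so the two conditional probabilities do
  have e1 : ∫⁻ ω, k (η ω) S * k (η' ω) S ∂P = ∫⁻ ω, k (η ω) S * k (η ω) S ∂P := by
    rw [← lintegral_mul_indicator_of_map_eq_compProd hη hξ hk hkS hS]
    have := lintegral_mul_indicator_of_map_eq_compProd hη' hξ hk' hr hS
    have hrp' : ∀ ω, r (η' ω) = k (η ω) S := fun ω => (congrFun hrp ω).symm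
    simp only [hrp'] at this
    exact this.symm
  have e2 : ∫⁻ ω, k (η' ω) S * k (η' ω) S ∂P = ∫⁻ ω, k (η ω) S * k (η ω) S ∂P := by
    rw [← lintegral_map (f := fun v => k v S * k v S) (by fun_prop) hη',
      ← lintegral_map (f := fun v => k v S * k v S) (by fun_prop) hη, hlaw1]
  -- The mean of the squared difference expands into the three second moments just compared, hence
  -- is zero.
  have hae : ∀ᵐ ω ∂P, k (η ω) S = k (η' ω) S := by
    have hint : ∀ {f : Ω → ENNReal}, Measurable f → (∀ ω, f ω ≤ 1) →
        Integrable (fun ω => (f ω).toReal) P := fun {f} hf h1 => by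
      refine Integrable.of_bound hf.ennreal_toReal.aestronglyMeasurable 1 (.of_forall fun ω => ?_)
      rw [Real.norm_of_nonneg ENNReal.toReal_nonneg]
      exact ENNReal.toReal_le_of_le_ofReal zero_le_one (by simpa using h1 ω)
    have hreal : ∀ {f : Ω → ENNReal}, Measurable f → (∀ ω, f ω ≤ 1) →
        ∫ ω, (f ω).toReal ∂P = (∫⁻ ω, f ω ∂P).toReal := fun {f} hf h1 =>
      integral_toReal hf.aemeasurable (.of_forall fun ω => (h1 ω).trans_lt ENNReal.one_lt_top)
    have hm : ∀ v v', k v S * k v' S ≤ 1 := fun v v' => mul_le_one' (hle _) (hle _)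
    have i1 := hint (hp.mul hp') fun ω => hm _ _
    have i2 := hint (hp.mul hp) fun ω => hm _ _
    have i3 := hint (hp'.mul hp') fun ω => hm _ _
    have e1' := hreal (hp.mul hp') fun ω => hm _ _
    have e2' := hreal (hp.mul hp) fun ω => hm _ _
    have e3' := hreal (hp'.mul hp') fun ω => hm _ _
    simp only [Pi.mul_apply] at e1' e2' e3' i1 i2 i3
    rw [e1] at e1'
    rw [e2] at e3'
    have hsq : ∫ ω, ((k (η ω) S).toReal - (k (η' ω) S).toReal) ^ 2 ∂P = 0 := by
      have : ∀ ω, ((k (η ω) S).toReal - (k (η' ω) S).toReal) ^ 2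
          = (k (η ω) S * k (η ω) S).toReal - 2 * (k (η ω) S * k (η' ω) S).toReal
            + (k (η' ω) S * k (η' ω) S).toReal := fun ω => by
        simp only [ENNReal.toReal_mul]; ring
      have i12 : Integrable (fun ω => (k (η ω) S * k (η ω) S).toReal
          - 2 * (k (η ω) S * k (η' ω) S).toReal) P := i2.sub (i1.const_mul 2)
      simp only [this]
      rw [integral_add i12 i3, integral_sub i2 (i1.const_mul 2),
        integral_const_mul, e1', e2', e3']
      ring
    have hi : Integrable (fun ω => ((k (η ω) S).toReal - (k (η' ω) S).toReal) ^ 2) P := by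
      refine ((i2.sub (i1.const_mul 2)).add i3).congr (.of_forall fun ω => ?_)
      simp only [Pi.add_apply, Pi.sub_apply, ENNReal.toReal_mul]; ring
    rw [integral_eq_zero_iff_of_nonneg (fun ω => sq_nonneg _) hi] at hsq
    filter_upwards [hsq] with ω hω
    have h0 : (k (η ω) S).toReal = (k (η' ω) S).toReal := by
      have := pow_eq_zero_iff (two_ne_zero) |>.1 hω
      linarith
    exact (ENNReal.toReal_eq_toReal_iff' (measure_ne_top _ _) (measure_ne_top _ _)).1 h0
  have := lintegral_mul_indicator_of_map_eq_compProd hη' hξ hk' hw hS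
  simp only [Function.comp_apply]
  rw [this]
  refine lintegral_congr_ae ?_
  filter_upwards [hae] with ω hω
  rw [hω]

/-- If, given `Z` and all the other `Y j`, each `Y i` has the conditional law `k i Z`, then given `Z`
the `Y i` are independent with these laws. -/
theorem map_prodMk_eq_compProd_infinitePi {ι : Type*} [Countable ι] {Z : Ω → V} {Y' : ι → Ω → Y}
    {k : ι → Kernel V Y} [∀ i, IsMarkovKernel (k i)] (hZ : Measurable Z)
    (hY : ∀ i, Measurable (Y' i))
    (hcond : ∀ i, ∃ m : MeasurableSpace Ω, Measurable[m] Z ∧ (∀ j ≠ i, Measurable[m] (Y' j)) ∧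
      ∀ (W : Ω → ENNReal) (S : Set Y), Measurable[m] W → MeasurableSet S →
        ∫⁻ ω, W ω * S.indicator 1 (Y' i ω) ∂P = ∫⁻ ω, W ω * k i (Z ω) S ∂P) :
    P.map (fun ω => (Z ω, fun i => Y' i ω)) = P.map Z ⊗ₘ Kernel.infinitePi k := by
  classical
  -- Indicators are replaced by conditional probabilities one at a time: the factors not yet
  -- replaced are measurable for the σ-algebra conditioned on, and the new factor is absorbed into
  -- the weight `g`.
  have key : ∀ (F : Finset ι) (S : ι → Set Y), (∀ i, MeasurableSet (S i)) →
      ∀ g : V → ENNReal, Measurable g →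
        ∫⁻ ω, g (Z ω) * ∏ i ∈ F, (S i).indicator 1 (Y' i ω) ∂P
          = ∫⁻ ω, g (Z ω) * ∏ i ∈ F, k i (Z ω) (S i) ∂P := by
    intro F S hS
    induction F using Finset.induction_on with
    | empty => intro g hg; simp
    | insert i F hi ih =>
      intro g hg
      obtain ⟨m, hmZ, hmY, hm⟩ := hcond i
      have hki : Measurable fun v => k i v (S i) := (k i).measurable_coe (hS i)
      have h1 := hm (fun ω => g (Z ω) * ∏ j ∈ F, (S j).indicator 1 (Y' j ω)) (S i)
        ((hg.comp hmZ).mul (Finset.measurable_prod _ fun j hj =>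
          (measurable_one.indicator (hS j)).comp (hmY j (by rintro rfl; exact hi hj)))) (hS i)
      have h2 := ih (fun v => g v * k i v (S i)) (hg.mul hki)
      simp only [Finset.prod_insert hi]
      calc _ = _ := lintegral_congr fun ω => by ring
        _ = _ := h1
        _ = _ := lintegral_congr fun ω => by ring
        _ = _ := h2
        _ = _ := lintegral_congr fun ω => by ring
  have hYm : Measurable fun ω i => Y' i ω := measurable_pi_lambda _ hY
  refine Measure.ext_prod fun {A T} hA hT => ?_
  -- With `A` fixed, restricting and projecting leaves finite measures on `ι → Y`, which cylinders
  -- determine.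
  have hμν : ∀ (μ : Measure (V × (ι → Y))) [IsFiniteMeasure μ] (T : Set (ι → Y)), MeasurableSet T →
      μ (A ×ˢ T) = (μ.restrict (A ×ˢ univ)).map Prod.snd T := fun μ _ T hT => by
    rw [map_apply measurable_snd hT, restrict_apply (measurable_snd hT)]
    congr 1
    ext p
    simp [and_comm]
  rw [hμν _ T hT, hμν _ T hT]
  congr 1
  have hbox : ∀ (F : Finset ι) (S : ι → Set Y), (∀ i, MeasurableSet (S i)) →
      P.map (fun ω => (Z ω, fun i => Y' i ω)) (A ×ˢ (F : Set ι).pi S)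
        = (P.map Z ⊗ₘ Kernel.infinitePi k) (A ×ˢ (F : Set ι).pi S) := by
    intro F S hS
    have hpi : MeasurableSet ((F : Set ι).pi S) := .pi F.countable_toSet fun i _ => hS i
    have hprod : Measurable fun v => A.indicator 1 v * ∏ i ∈ F, k i v (S i) :=
      (measurable_one.indicator hA).mul
        (Finset.measurable_prod _ fun i _ => (k i).measurable_coe (hS i))
    rw [map_apply (hZ.prodMk hYm) (hA.prod hpi), Measure.compProd_apply_prod hA hpi,
      ← lintegral_indicator hA, ← lintegral_indicator_one ((hZ.prodMk hYm) (hA.prod hpi))]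
    have h2 : ∀ v, A.indicator (fun v => Kernel.infinitePi k v ((F : Set ι).pi S)) v
        = A.indicator 1 v * ∏ i ∈ F, k i v (S i) := fun v => by
      have : Kernel.infinitePi k v ((F : Set ι).pi S) = ∏ i ∈ F, k i v (S i) := by
        rw [Kernel.infinitePi_apply, infinitePi_pi _ fun i _ => hS i]
      by_cases hv : v ∈ A <;> simp [hv, this]
    simp only [h2]
    rw [lintegral_map hprod hZ, ← key F S hS _ (measurable_one.indicator hA)]
    refine lintegral_congr fun ω => ?_
    by_cases hv : Z ω ∈ A
    · simp only [indicator_of_mem hv, Pi.one_apply, one_mul]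
      by_cases hF : ∀ i ∈ F, Y' i ω ∈ S i
      · rw [Finset.prod_eq_one fun i hi => by simp [hF i hi], indicator_of_mem]
        · rfl
        · exact ⟨hv, fun i hi => hF i hi⟩
      · rw [indicator_of_notMem fun hmem => hF fun i hi => hmem.2 i hi]
        push Not at hF
        obtain ⟨i, hi, hiS⟩ := hF
        exact (Finset.prod_eq_zero hi (by simp [hiS])).symm
    · rw [indicator_of_notMem fun hmem => hv hmem.1]
      simp [hv]
  refine ext_of_generate_finite _ (generateFrom_squareCylinders (α := fun _ : ι => Y)).symm
    (isPiSystem_squareCylinders (fun _ => MeasurableSpace.isPiSystem_measurableSet)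
      (fun _ => mem_ofPred.2 MeasurableSet.univ)) ?_ ?_
  · rintro t ⟨F, S, hS, rfl⟩
    have hS' : ∀ i, MeasurableSet (S i) := fun i => hS i (mem_univ i)
    have hpi : MeasurableSet ((F : Set ι).pi S) := .pi F.countable_toSet fun i _ => hS' i
    rw [← hμν _ _ hpi, ← hμν _ _ hpi, hbox F S hS']
  · rw [← hμν _ _ .univ, ← hμν _ _ .univ]
    simpa using hbox ∅ (fun _ => univ) fun _ => .univ

end ConditionalIndependence

end ProbabilityTheory

/-! ### Exchangeable dissociated semimetrics as a closed condition -/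

theorem isClosedEmbedding_coe_MInfty :
    IsClosedEmbedding (Subtype.val : MInfty → ℕ → ℕ → unitInterval) := by
  refine ⟨IsEmbedding.subtypeVal, ?_⟩
  have : range (Subtype.val : MInfty → ℕ → ℕ → unitInterval)
      = (⋂ i, ⋂ j, {d | d i j = d j i}) ∩ ⋂ i, {d | d i i = 0} := by
    ext d
    simp
  rw [this]
  exact (isClosed_iInter fun i => isClosed_iInter fun j =>
    isClosed_eq (by fun_prop) (by fun_prop)).inter
    (isClosed_iInter fun i => isClosed_eq (by fun_prop) (by fun_prop))

instance : CompactSpace MInfty := isClosedEmbedding_coe_MInfty.compactSpace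

instance : SecondCountableTopology MInfty :=
  isClosedEmbedding_coe_MInfty.isEmbedding.secondCountableTopology

instance : TopologicalSpace.MetrizableSpace MInfty :=
  isClosedEmbedding_coe_MInfty.isEmbedding.metrizableSpace

/-- The matrix `(d (σ i) (σ j))`. -/
def reindex (σ : ℕ → ℕ) (d : MInfty) : MInfty :=
  ⟨fun i j => d.1 (σ i) (σ j), fun _ _ => d.2.1 _ _, fun _ => d.2.2 _⟩

theorem continuous_reindex (σ : ℕ → ℕ) : Continuous (reindex σ) := by
  refine Continuous.subtype_mk (continuous_pi fun i => continuous_pi fun j => ?_) _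
  exact (continuous_apply (σ j)).comp ((continuous_apply (σ i)).comp continuous_subtype_val)

@[fun_prop]
theorem measurable_reindex (σ : ℕ → ℕ) : Measurable (reindex σ) :=
  (continuous_reindex σ).measurable

theorem measurable_entry (i j : ℕ) : Measurable fun d : MInfty => d.1 i j :=
  (measurable_pi_apply j).comp ((measurable_pi_apply i).comp measurable_subtype_coe)

theorem continuous_entry (i j : ℕ) : Continuous fun d : MInfty => d.1 i j :=
  (continuous_apply j).comp ((continuous_apply i).comp continuous_subtype_val)

theorem continuous_coe_entry (i j : ℕ) : Continuous fun d : MInfty => (d.1 i j : ℝ) :=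
  continuous_subtype_val.comp (continuous_entry i j)

/-- A nonnegative continuous function whose mean vanishes exactly when the triangle inequality holds
almost surely; this turns that condition into a weakly closed one. -/
theorem continuous_triangleDefect :
    Continuous fun d : MInfty => max 0 ((d.1 0 2 : ℝ) - d.1 0 1 - d.1 1 2) :=
  continuous_const.max (((continuous_coe_entry 0 2).sub (continuous_coe_entry 0 1)).sub
    (continuous_coe_entry 1 2))

/-- Laws of exchangeable dissociated random semimetrics: the law does not change under injective
reindexing, the submatrices on the even and on the odd indices are independent, and the triangle
inequality holds almost surely. -/
structure IsExchangeableDissociated (κ : Measure MInfty) : Prop where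
  map_reindex : ∀ σ : ℕ → ℕ, Function.Injective σ → κ.map (reindex σ) = κ
  map_even_odd :
    κ.map (fun d => (reindex (fun i => 2 * i) d, reindex (fun i => 2 * i + 1) d)) = κ.prod κ
  triangle : ∀ᵐ d ∂κ, (d.1 0 2 : ℝ) ≤ d.1 0 1 + d.1 1 2

theorem measurableSet_firstTriangle :
    MeasurableSet {d : MInfty | (d.1 0 2 : ℝ) ≤ d.1 0 1 + d.1 1 2} := by
  exact (isClosed_le (continuous_coe_entry 0 2)
    ((continuous_coe_entry 0 1).add (continuous_coe_entry 1 2))).measurableSet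

/-- Each condition is an equation between weakly continuous functions of `κ`: push-forwards along
continuous maps, the product `κ.prod κ`, and the mean triangle defect. -/
theorem isClosed_isExchangeableDissociated :
    IsClosed {κ : ProbabilityMeasure MInfty | IsExchangeableDissociated (κ : Measure MInfty)} := by
  have h : {κ : ProbabilityMeasure MInfty | IsExchangeableDissociated (κ : Measure MInfty)}
      = (⋂ σ : {σ : ℕ → ℕ // Function.Injective σ}, {κ : ProbabilityMeasure MInfty |
            κ.map (continuous_reindex σ.1).measurable.aemeasurable = κ})
        ∩ {κ : ProbabilityMeasure MInfty | κ.map (f := fun d => (reindex (fun i => 2 * i) d,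
            reindex (fun i => 2 * i + 1) d)) (by fun_prop) = κ.prod κ}
        ∩ {κ : ProbabilityMeasure MInfty |
            ∫ d, max 0 ((d.1 0 2 : ℝ) - d.1 0 1 - d.1 1 2) ∂(κ : Measure MInfty) = 0} := by
    ext κ
    have htri : (∫ d, max 0 ((d.1 0 2 : ℝ) - d.1 0 1 - d.1 1 2) ∂(κ : Measure MInfty) = 0) ↔
        ∀ᵐ d ∂(κ : Measure MInfty), (d.1 0 2 : ℝ) ≤ d.1 0 1 + d.1 1 2 := by
      rw [integral_eq_zero_iff_of_nonneg (f := fun d : MInfty =>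
        max 0 ((d.1 0 2 : ℝ) - d.1 0 1 - d.1 1 2)) (fun d => le_max_left _ _)]
      · refine eventually_congr (.of_forall fun d => ?_)
        simp only [Pi.zero_apply, max_eq_left_iff]
        constructor <;> intro h <;> linarith
      · refine Integrable.of_bound continuous_triangleDefect.aestronglyMeasurable 1 (.of_forall fun d => ?_)
        rw [Real.norm_of_nonneg (le_max_left _ _)]
        have h1 := (d.1 0 2).2.2
        have h2 := (d.1 0 1).2.1
        have h3 := (d.1 1 2).2.1
        exact max_le zero_le_one (by linarith)
    simp only [mem_inter_iff, mem_iInter, mem_ofPred_eq, htri]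
    constructor
    · rintro ⟨h1, h2, h3⟩
      refine ⟨⟨fun σ => Subtype.ext ?_, Subtype.ext ?_⟩, h3⟩
      · exact h1 σ.1 σ.2
      · exact h2
    · rintro ⟨⟨h1, h2⟩, h3⟩
      refine ⟨fun σ hσ => ?_, ?_, h3⟩
      · exact congrArg Subtype.val (h1 ⟨σ, hσ⟩)
      · exact congrArg Subtype.val h2
  rw [h]
  refine ((isClosed_iInter fun σ => ?_).inter ?_).inter ?_
  · exact isClosed_eq (ProbabilityMeasure.continuous_map (continuous_reindex σ.1)) continuous_id
  · exact isClosed_eq (ProbabilityMeasure.continuous_map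
      ((continuous_reindex _).prodMk (continuous_reindex _)))
      (ProbabilityMeasure.continuous_prod.comp (continuous_id.prodMk continuous_id))
  · exact isClosed_eq (ProbabilityMeasure.continuous_integral_continuousMap
      (⟨_, continuous_triangleDefect⟩ : C(MInfty, ℝ))) continuous_const

/-- Sampling measures of mm-spaces are exchangeable and dissociated. -/
theorem MMSpace.isExchangeableDissociated_tau (X : MMSpace) :
    IsExchangeableDissociated (X.tau : Measure MInfty) where
  map_reindex σ hσ := by
    change ((Measure.infinitePi fun _ : ℕ => X.μ).map X.rho).map (reindex σ)
      = (Measure.infinitePi fun _ : ℕ => X.μ).map X.rho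
    conv_rhs => rw [← Measure.map_infinitePi_infinitePi_of_inj (P := fun _ : ℕ => X.μ) hσ]
    rw [Measure.map_map (by fun_prop) X.measurable_rho,
      Measure.map_map X.measurable_rho (by fun_prop)]
    rfl
  map_even_odd := by
    change ((Measure.infinitePi fun _ : ℕ => X.μ).map X.rho).map _
      = ((Measure.infinitePi fun _ : ℕ => X.μ).map X.rho).prod
        ((Measure.infinitePi fun _ : ℕ => X.μ).map X.rho)
    rw [Measure.map_prod_map _ _ X.measurable_rho X.measurable_rho,
      ← Measure.infinitePi_map_pair_of_injective (fun _ : ℕ => X.μ) (σ := fun i : ℕ => 2 * i)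
        (τ := fun i : ℕ => 2 * i + 1) (fun a b h => by simpa using h) (fun a b h => by simpa using h)
        (fun i j => by omega),
      Measure.map_map (by fun_prop) X.measurable_rho,
      Measure.map_map (X.measurable_rho.prodMap X.measurable_rho) (by fun_prop)]
    rfl
  triangle := by
    change ∀ᵐ d ∂((Measure.infinitePi fun _ : ℕ => X.μ).map X.rho), _
    rw [ae_map_iff X.measurable_rho.aemeasurable measurableSet_firstTriangle]
    exact .of_forall fun x => dist_triangle (x 0) (x 1) (x 2)

theorem isExchangeableDissociated_of_mem_chiBar {κ : ProbabilityMeasure MInfty} (hκ : κ ∈ chiBar) :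
    IsExchangeableDissociated (κ : Measure MInfty) :=
  closure_minimal (range_subset_iff.2 fun X => X.isExchangeableDissociated_tau)
    isClosed_isExchangeableDissociated hκ

/-! ### Sampling from qmm-spaces -/

/-- The matrix of laws `(s (σ i) (σ j))`. -/
noncomputable def reindexHat (σ : ℕ → ℕ) (s : MHatInfty) : MHatInfty :=
  ⟨fun i j => s.1 (σ i) (σ j), fun _ _ => s.2.1 _ _, fun _ => s.2.2 _⟩

/-- The action of an injection on the positions above the diagonal. -/
def UpperPair.map {σ : ℕ → ℕ} (hσ : Function.Injective σ) (p : UpperPair) : UpperPair :=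
  ⟨(min (σ p.1.1) (σ p.1.2), max (σ p.1.1) (σ p.1.2)), min_lt_max.2 (hσ.ne p.2.ne)⟩

theorem UpperPair.map_eq_map_iff {σ τ : ℕ → ℕ} (hσ : Function.Injective σ)
    (hτ : Function.Injective τ) {p q : UpperPair} :
    UpperPair.map hσ p = UpperPair.map hτ q ↔
      (σ p.1.1 = τ q.1.1 ∧ σ p.1.2 = τ q.1.2) ∨ (σ p.1.1 = τ q.1.2 ∧ σ p.1.2 = τ q.1.1) := by
  simp only [UpperPair.map, Subtype.mk.injEq, Prod.mk.injEq]
  omega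

theorem UpperPair.map_injective {σ : ℕ → ℕ} (hσ : Function.Injective σ) :
    Function.Injective (UpperPair.map hσ) := by
  intro p q h
  rw [UpperPair.map_eq_map_iff hσ hσ] at h
  rcases h with ⟨h1, h2⟩ | ⟨h1, h2⟩
  · exact Subtype.ext (Prod.ext (hσ h1) (hσ h2))
  · have h1 := hσ h1
    have h2 := hσ h2
    have := p.2
    have := q.2
    omega

theorem reindex_symmFill {σ : ℕ → ℕ} (hσ : Function.Injective σ) (e : UpperPair → unitInterval) :
    reindex σ (symmFill e) = symmFill fun p => e (p.map hσ) := by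
  refine Subtype.ext (funext fun i => funext fun j => ?_)
  simp only [reindex, symmFill, UpperPair.map]
  rcases lt_trichotomy i j with h | rfl | h
  · rcases lt_or_gt_of_ne (hσ.ne h.ne) with h' | h'
    · simp [h, h', h'.le]
    · simp [h, h', h'.le, h'.not_gt]
  · simp
  · rcases lt_or_gt_of_ne (hσ.ne h.ne) with h' | h'
    · simp [h, h', h'.le, h.not_gt, h'.not_gt]
    · simp [h, h', h'.le, h.not_gt]

theorem apply_map_eq {σ : ℕ → ℕ} (hσ : Function.Injective σ) (s : MHatInfty) (p : UpperPair) :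
    s.1 (p.map hσ).1.1 (p.map hσ).1.2 = s.1 (σ p.1.1) (σ p.1.2) := by
  rcases le_total (σ p.1.1) (σ p.1.2) with h | h
  · simp [UpperPair.map, h]
  · simp [UpperPair.map, h, s.2.1 (σ p.1.2)]

theorem matrixLaw_map_reindex {σ : ℕ → ℕ} (hσ : Function.Injective σ) (s : MHatInfty) :
    (matrixLaw s : Measure MInfty).map (reindex σ) = matrixLaw (reindexHat σ s) := by
  change ((Measure.infinitePi _).map symmFill).map _ = (Measure.infinitePi _).map symmFill
  rw [Measure.map_map (by fun_prop) measurable_symmFill]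
  have h1 : (reindex σ ∘ symmFill) = symmFill ∘ fun e p => e (UpperPair.map hσ p) :=
    funext (reindex_symmFill hσ)
  rw [h1, ← Measure.map_map measurable_symmFill (by fun_prop),
    Measure.map_infinitePi_infinitePi_of_inj (UpperPair.map_injective hσ)]
  simp only [apply_map_eq, reindexHat]

/-- Blocks along disjoint index sets use disjoint sets of independent entries. -/
theorem matrixLaw_map_reindex_pair {σ τ : ℕ → ℕ} (hσ : Function.Injective σ)
    (hτ : Function.Injective τ) (hστ : ∀ i j, σ i ≠ τ j) (s : MHatInfty) :
    (matrixLaw s : Measure MInfty).map (fun d => (reindex σ d, reindex τ d))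
      = (matrixLaw (reindexHat σ s) : Measure MInfty).prod (matrixLaw (reindexHat τ s)) := by
  change ((Measure.infinitePi _).map symmFill).map _
    = ((Measure.infinitePi _).map symmFill).prod ((Measure.infinitePi _).map symmFill)
  rw [Measure.map_map (by fun_prop) measurable_symmFill,
    Measure.map_prod_map _ _ measurable_symmFill measurable_symmFill]
  have h1 : ((fun d => (reindex σ d, reindex τ d)) ∘ symmFill)
      = Prod.map symmFill symmFill ∘
        fun e => (fun p => e (UpperPair.map hσ p), fun p => e (UpperPair.map hτ p)) :=
    funext fun e => Prod.ext (reindex_symmFill hσ e) (reindex_symmFill hτ e)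
  rw [h1, ← Measure.map_map (measurable_symmFill.prodMap measurable_symmFill) (by fun_prop),
    Measure.infinitePi_map_pair_of_injective _ (UpperPair.map_injective hσ)
      (UpperPair.map_injective hτ)]
  · simp only [apply_map_eq, reindexHat]
  · intro p q h
    rw [UpperPair.map_eq_map_iff] at h
    rcases h with h | h
    · exact hστ _ _ h.1
    · exact hστ _ _ h.1

namespace MeasureTheory.Measure

theorem map_bind {α β γ : Type*} [MeasurableSpace α] [MeasurableSpace β] [MeasurableSpace γ]
    (m : Measure α) {k : α → Measure β} (hk : Measurable k) {g : β → γ} (hg : Measurable g) :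
    (m.bind k).map g = m.bind fun a => (k a).map g := by
  ext s hs
  rw [map_apply hg hs, bind_apply (hg hs) hk.aemeasurable,
    bind_apply hs (m := m) (f := fun a => (k a).map g) ((measurable_map g hg).comp hk).aemeasurable]
  exact lintegral_congr fun a => (map_apply hg hs).symm

theorem bind_map {α β γ : Type*} [MeasurableSpace α] [MeasurableSpace β] [MeasurableSpace γ]
    (m : Measure α) {f : α → β} (hf : Measurable f) {k : β → Measure γ} (hk : Measurable k) :
    (m.map f).bind k = m.bind fun a => k (f a) := by
  ext s hs
  rw [bind_apply hs hk.aemeasurable, bind_apply hs (f := fun a => k (f a)) (hk.comp hf).aemeasurable,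
    lintegral_map (f := fun b => k b s) ((measurable_coe hs).comp hk) hf]

theorem infinitePi_map_eval_prod₃ {ι X : Type*} [MeasurableSpace X] (P : ι → Measure X)
    [∀ i, IsProbabilityMeasure (P i)] {i j k : ι} (hij : i ≠ j) (hik : i ≠ k) (hjk : j ≠ k) :
    (infinitePi P).map (fun ω => (ω i, ω j, ω k)) = (P i).prod ((P j).prod (P k)) := by
  have h := iIndepFun_infinitePi (P := P) (X := fun _ x => x) (fun _ => measurable_id)
  have h1 : IndepFun (fun ω : ι → X => ω i) (fun ω : ι → X => (ω j, ω k)) (infinitePi P) :=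
    (h.indepFun_prodMk (fun i => measurable_pi_apply i) j k i hij.symm hik.symm).symm
  rw [indepFun_iff_map_prod_eq_prod_map_map (measurable_pi_apply i).aemeasurable
    ((measurable_pi_apply j).prodMk (measurable_pi_apply k)).aemeasurable] at h1
  rw [h1, infinitePi_map_eval_prod hjk, infinitePi_map_eval]

end MeasureTheory.Measure

/-- The law of the entries above the diagonal of a sampled matrix. -/
noncomputable def entryLaw {α : Type*} [MeasurableSpace α] (μ : Measure α) [IsProbabilityMeasure μ]
    (d : α → α → ProbabilityMeasure unitInterval) : Measure (UpperPair → unitInterval) :=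
  (Measure.infinitePi fun _ : ℕ => μ).bind fun x =>
    Measure.infinitePi fun p : UpperPair => (d (x p.1.1) (x p.1.2) : Measure unitInterval)

theorem measurable_infinitePi_entries {α : Type*} [MeasurableSpace α]
    {d : α → α → ProbabilityMeasure unitInterval} (hd : Measurable (Function.uncurry d)) :
    Measurable fun x : ℕ → α =>
      Measure.infinitePi fun p : UpperPair => (d (x p.1.1) (x p.1.2) : Measure unitInterval) :=
  Measure.measurable_infinitePi fun p => measurable_subtype_coe.comp
    (hd.comp ((measurable_pi_apply (X := fun _ : ℕ => α) p.1.1).prodMk (measurable_pi_apply p.1.2)))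

/-- The positions (0,1), (1,2), (0,2) are distinct, so given the points their entries are
independent, and the points 0, 1, 2 have law `μ` cubed. This passes between the triangle condition
of a qmm-space and one on the sampled matrix. -/
theorem entryLaw_triangle_iff {α : Type*} [MeasurableSpace α] {μ : Measure α}
    [IsProbabilityMeasure μ] {d : α → α → ProbabilityMeasure unitInterval}
    (hd : Measurable (Function.uncurry d)) {C : Set (unitInterval × unitInterval × unitInterval)}
    (hC : MeasurableSet C) :
    (∀ᵐ e ∂entryLaw μ d, (e ⟨(0, 1), by decide⟩, e ⟨(1, 2), by decide⟩, e ⟨(0, 2), by decide⟩) ∈ C) ↔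
    ∀ᵐ t : α × α × α ∂(μ.prod (μ.prod μ)),
      ∀ᵐ l ∂((d t.1 t.2.1 : Measure unitInterval).prod
        ((d t.2.1 t.2.2 : Measure unitInterval).prod (d t.1 t.2.2 : Measure unitInterval))), l ∈ C := by
  have hm : Measurable fun t : α × α × α => ((d t.1 t.2.1 : Measure unitInterval).prod
        ((d t.2.1 t.2.2 : Measure unitInterval).prod (d t.1 t.2.2 : Measure unitInterval))) := by
    have h1 : Measurable fun t : α × α × α => (d t.2.1 t.2.2).prod (d t.1 t.2.2) :=
      (ProbabilityMeasure.measurable_fun_prod.comp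
        ((hd.comp (by fun_prop : Measurable fun t : α × α × α => (t.2.1, t.2.2))).prodMk
          (hd.comp (by fun_prop : Measurable fun t : α × α × α => (t.1, t.2.2))))).subtype_mk
    exact ProbabilityMeasure.measurable_fun_prod.comp
      ((hd.comp (by fun_prop : Measurable fun t : α × α × α => (t.1, t.2.1))).prodMk h1)
  have hproj : Measurable fun e : UpperPair → unitInterval =>
    (e ⟨(0, 1), by decide⟩, e ⟨(1, 2), by decide⟩, e ⟨(0, 2), by decide⟩) := by fun_prop
  have hf := (Measure.measurable_coe hC.compl).comp hm
  rw [ae_iff, ← Measure.infinitePi_map_eval_prod₃ (fun _ : ℕ => μ) (i := 0) (j := 1) (k := 2)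
    (by decide) (by decide) (by decide)]
  rw [ae_map_iff (by fun_prop) (by exact hf (measurableSet_singleton 0)), entryLaw,
    Measure.bind_apply (by exact hproj hC.compl) (measurable_infinitePi_entries hd).aemeasurable,
    lintegral_eq_zero_iff
      (by exact (Measure.measurable_coe (hproj hC.compl)).comp (measurable_infinitePi_entries hd))]
  refine eventually_congr (.of_forall fun x => ?_)
  rw [ae_iff, ← Measure.infinitePi_map_eval_prod₃
    (fun p : UpperPair => (d (x p.1.1) (x p.1.2) : Measure unitInterval))
    (i := ⟨(0, 1), by decide⟩) (j := ⟨(1, 2), by decide⟩) (k := ⟨(0, 2), by decide⟩)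
    (by decide) (by decide) (by decide)]
  rw [Measure.map_apply hproj (by exact hC.compl)]
  rfl

/-- The triples of lengths that satisfy the triangle inequalities. -/
def triangleSet : Set (unitInterval × unitInterval × unitInterval) :=
  {l | (l.1 : ℝ) ≤ l.2.1 + l.2.2 ∧ (l.2.1 : ℝ) ≤ l.1 + l.2.2 ∧ (l.2.2 : ℝ) ≤ l.1 + l.2.1}

theorem measurableSet_triangleSet : MeasurableSet triangleSet := by
  have hc : IsClosed triangleSet := by
    simp only [triangleSet, ofPred_and]
    refine (isClosed_le ?_ ?_).inter ((isClosed_le ?_ ?_).inter (isClosed_le ?_ ?_)) <;> fun_prop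
  exact hc.measurableSet

namespace QMMSpace

theorem coe_tau (X : QMMSpace.{u}) : (X.tau : Measure MInfty)
    = (Measure.infinitePi fun _ : ℕ => X.μ).bind
      fun x => (matrixLaw (X.rhoHat x) : Measure MInfty) := by
  change (((Measure.infinitePi fun _ : ℕ => X.μ).map X.rhoHat).map matrixLaw).bind _ = _
  rw [Measure.bind_map _ measurable_matrixLaw (k := fun m => (m : Measure MInfty))
      measurable_subtype_coe,
    Measure.bind_map _ X.measurable_rhoHat (k := fun s => (matrixLaw s : Measure MInfty))
      (measurable_subtype_coe.comp measurable_matrixLaw)]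

theorem coe_tau_eq_map_entryLaw (X : QMMSpace.{u}) :
    (X.tau : Measure MInfty) = (entryLaw X.μ X.d).map symmFill := by
  rw [coe_tau, entryLaw, Measure.map_bind _ (measurable_infinitePi_entries X.measurable_d)
    measurable_symmFill]
  rfl

/-- Given the points, even and odd blocks are independent, and each depends only on the even,
respectively odd, points, which are themselves independent; so the mixture of products is the
product of the mixtures. -/
theorem isExchangeableDissociated_tau (X : QMMSpace.{u}) :
    IsExchangeableDissociated (X.tau : Measure MInfty) := by
  have hM : Measurable fun x => (matrixLaw (X.rhoHat x) : Measure MInfty) :=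
    measurable_subtype_coe.comp (measurable_matrixLaw.comp X.measurable_rhoHat)
  refine ⟨fun σ hσ => ?_, ?_, ?_⟩
  · rw [coe_tau, Measure.map_bind _ hM (by fun_prop)]
    conv_rhs => rw [← Measure.map_infinitePi_infinitePi_of_inj (P := fun _ : ℕ => X.μ) hσ]
    rw [Measure.bind_map _ (by fun_prop) hM]
    simp only [matrixLaw_map_reindex hσ]
    rfl
  · refine Measure.ext_prod fun {A B} hA hB => ?_
    have h2 : Function.Injective fun i : ℕ => 2 * i := fun a b h => by simpa using h
    have h3 : Function.Injective fun i : ℕ => 2 * i + 1 := fun a b h => by simpa using h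
    have h23 : ∀ i j : ℕ, 2 * i ≠ 2 * j + 1 := fun i j => by omega
    rw [Measure.prod_prod, coe_tau, Measure.map_bind _ hM (by fun_prop)]
    simp only [matrixLaw_map_reindex_pair h2 h3 h23]
    have e : ∀ x : ℕ → X.carrier,
        (matrixLaw (reindexHat (fun i => 2 * i) (X.rhoHat x)) : Measure MInfty).prod
          (matrixLaw (reindexHat (fun i => 2 * i + 1) (X.rhoHat x)) : Measure MInfty)
        = (matrixLaw (X.rhoHat fun i => x (2 * i)) : Measure MInfty).prod
          (matrixLaw (X.rhoHat fun i => x (2 * i + 1)) : Measure MInfty) := fun x => rfl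
    simp only [e]
    have hP : Measurable fun q : (ℕ → X.carrier) × (ℕ → X.carrier) =>
        (matrixLaw (X.rhoHat q.1) : Measure MInfty).prod
          (matrixLaw (X.rhoHat q.2) : Measure MInfty) :=
      ProbabilityMeasure.measurable_fun_prod.comp
        (((measurable_matrixLaw.comp X.measurable_rhoHat).comp measurable_fst).prodMk
        ((measurable_matrixLaw.comp X.measurable_rhoHat).comp measurable_snd))
    rw [← Measure.bind_map (f := fun x : ℕ → X.carrier => (fun i => x (2 * i), fun i => x (2 * i + 1)))
        _ (by fun_prop) hP,
      Measure.infinitePi_map_pair_of_injective _ h2 h3 h23,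
      Measure.bind_apply (hA.prod hB) hP.aemeasurable, Measure.bind_apply hA hM.aemeasurable,
      Measure.bind_apply hB hM.aemeasurable]
    simp only [Measure.prod_prod]
    exact lintegral_prod_mul ((Measure.measurable_coe hA).comp hM).aemeasurable
      ((Measure.measurable_coe hB).comp hM).aemeasurable
  · have h := (entryLaw_triangle_iff X.measurable_d measurableSet_triangleSet).2 X.triangle
    rw [coe_tau_eq_map_entryLaw, ae_map_iff measurable_symmFill.aemeasurable
      measurableSet_firstTriangle]
    filter_upwards [h] with e he
    simpa [symmFill] using he.2.2

end QMMSpace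

/-! ### Approximation by mm-spaces -/

/-- A continuous function on `M_∞` depends, up to a small error, on finitely many entries only. -/
theorem exists_finite_dependence {f : MInfty → ℝ} (hf : Continuous f) {ε : ℝ} (hε : 0 < ε) :
    ∃ k : ℕ, ∀ d d' : MInfty, (∀ i < k, ∀ j < k, d.1 i j = d'.1 i j) → |f d - f d'| < ε := by
  by_contra! h
  -- Otherwise pairs agreeing on ever larger corners keep their values apart; by compactness a
  -- subsequence of the pairs has a common limit, against continuity.
  choose x y hxy hf' using h
  obtain ⟨a, φ, hφ, ha⟩ := CompactSpace.tendsto_subseq x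
  have hy : Tendsto (y ∘ φ) atTop (𝓝 a) := by
    rw [tendsto_subtype_rng, tendsto_pi_nhds]
    intro i
    rw [tendsto_pi_nhds]
    intro j
    refine (((continuous_entry i j).tendsto a).comp ha).congr' ?_
    filter_upwards [eventually_gt_atTop i, eventually_gt_atTop j] with k hi hj
    exact hxy (φ k) i (hi.trans_le (hφ.id_le k)) j (hj.trans_le (hφ.id_le k))
  have h0 : Tendsto (fun k => |f (x (φ k)) - f (y (φ k))|) atTop (𝓝 0) := by
    have := (((hf.tendsto a).comp ha).sub ((hf.tendsto a).comp hy)).abs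
    simpa using this
  exact absurd (ge_of_tendsto' h0 fun k => hf' (φ k)) (not_le.2 hε)

theorem exists_injective_extension {t : ℕ → ℕ} {k : ℕ} (ht : InjOn t (Iio k)) :
    ∃ σ : ℕ → ℕ, Function.Injective σ ∧ ∀ i < k, σ i = t i := by
  let M := ∑ i ∈ Finset.range k, t i
  have hM : ∀ i < k, t i ≤ M := fun i hi =>
    Finset.single_le_sum (f := t) (fun _ _ => Nat.zero_le _) (Finset.mem_range.2 hi)
  refine ⟨fun i => if i < k then t i else M + 1 + i, fun i j hij => ?_, fun i hi => by simp [hi]⟩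
  dsimp only at hij
  split_ifs at hij with hi hj hj
  · exact ht hi hj hij
  · have := hM i hi; omega
  · have := hM j hj; omega
  · omega

namespace IsExchangeableDissociated

variable {κ : Measure MInfty}

/-- Three distinct indices are the images of 0, 1, 2 under some injection; with a repeated index the
inequality holds for every matrix. -/
theorem ae_triangle (hκ : IsExchangeableDissociated κ) :
    ∀ᵐ d ∂κ, ∀ i j k, (d.1 i k : ℝ) ≤ d.1 i j + d.1 j k := by
  refine ae_all_iff.2 fun i => ae_all_iff.2 fun j => ae_all_iff.2 fun k => ?_
  by_cases hij : i = j
  · refine .of_forall fun d => ?_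
    subst hij
    simp [d.2.2]
  by_cases hjk : j = k
  · refine .of_forall fun d => ?_
    subst hjk
    simp [d.2.2]
  by_cases hik : i = k
  · refine .of_forall fun d => ?_
    subst hik
    rw [d.2.2]
    exact add_nonneg (d.1 i j).2.1 (d.1 j i).2.1
  let t : ℕ → ℕ := fun n => if n = 0 then i else if n = 1 then j else k
  obtain ⟨σ, hσ, hσt⟩ := exists_injective_extension (t := t) (k := 3) (by
    intro a ha b hb hab
    simp only [mem_Iio] at ha hb
    interval_cases a <;> interval_cases b <;> simp_all [t, eq_comm])
  have h := hκ.triangle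
  rw [← hκ.map_reindex σ hσ] at h
  filter_upwards [ae_of_ae_map (measurable_reindex σ).aemeasurable h] with d hd
  simpa [reindex, hσt, t] using hd

/-- The maps `t n` need not be injective. A test function depends up to a small error on a finite
corner, and there `t n` eventually agrees with an injection, to which exchangeability applies. -/
theorem tendsto_integral_reindex [IsProbabilityMeasure κ] (hκ : IsExchangeableDissociated κ)
    {f : MInfty → ℝ} (hf : Continuous f) {t : ℕ → ℕ → ℕ}
    (ht : ∀ i j, i ≠ j → ∀ᶠ n in atTop, t n i ≠ t n j) :
    Tendsto (fun n => ∫ d, f (reindex (t n) d) ∂κ) atTop (𝓝 (∫ d, f d ∂κ)) := by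
  have hint : ∀ σ, Integrable (fun d => f (reindex σ d)) κ := fun σ => by
    obtain ⟨C, hC⟩ := isCompact_univ.exists_bound_of_continuousOn hf.continuousOn
    exact Integrable.of_bound (hf.comp (continuous_reindex σ)).aestronglyMeasurable C
      (.of_forall fun d => hC _ (mem_univ _))
  rw [Metric.tendsto_nhds]
  intro ε hε
  obtain ⟨k, hk⟩ := exists_finite_dependence hf (half_pos hε)
  have hev : ∀ᶠ n in atTop, ∀ i ∈ Finset.range k, ∀ j ∈ Finset.range k, i ≠ j → t n i ≠ t n j := by
    simp only [Finset.eventually_all]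
    intro i _ j _
    by_cases hij : i = j
    · simp [hij]
    · filter_upwards [ht i j hij] with n hn _ using hn
  filter_upwards [hev] with n hn
  obtain ⟨σ, hσ, hσt⟩ := exists_injective_extension (t := t n) (k := k) (by
    intro a ha b hb hab
    by_contra hne
    exact hn a (Finset.mem_range.2 ha) b (Finset.mem_range.2 hb) hne hab)
  have h1 : ∫ d, f d ∂κ = ∫ d, f (reindex σ d) ∂κ := by
    conv_lhs => rw [← hκ.map_reindex σ hσ]
    exact integral_map (measurable_reindex σ).aemeasurable hf.aestronglyMeasurable
  rw [h1, dist_eq_norm, ← integral_sub (hint _) (hint _)]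
  refine (norm_integral_le_of_norm_le_const (C := ε / 2) (.of_forall fun d => ?_)).trans_lt ?_
  · refine (hk _ _ fun i hi j hj => ?_).le
    simp [reindex, hσt i hi, hσt j hj]
  · simp [hε]

end IsExchangeableDissociated

/-- The standard Gaussian measure, used as a source of diffuse labels of full support. -/
noncomputable abbrev labelMeasure : Measure ℝ := gaussianReal 0 1

instance : NullSingletonClass labelMeasure := nullSingletonClass_gaussianReal one_ne_zero

/-- The law of a sequence of independent labels. -/
noncomputable abbrev labelSequence : Measure (ℕ → ℝ) := Measure.infinitePi fun _ => labelMeasure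

/-- The number of the cell of length `1 / (n + 1)` that contains `u`. -/
noncomputable def cell (n : ℕ) (u : ℝ) : ℕ := Equiv.intEquivNat ⌊(n + 1) * u⌋

@[fun_prop]
theorem measurable_cell (n : ℕ) : Measurable (cell n) :=
  (measurable_of_countable Equiv.intEquivNat).comp
    (Int.measurable_floor.comp (measurable_const.mul measurable_id))

theorem eventually_cell_ne {u v : ℝ} (h : u ≠ v) : ∀ᶠ n in atTop, cell n u ≠ cell n v := by
  have h1 : Tendsto (fun n : ℕ => ((n : ℝ) + 1) * |u - v|) atTop atTop :=
    (tendsto_natCast_atTop_atTop.atTop_add tendsto_const_nhds).atTop_mul_const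
      (abs_pos.2 (sub_ne_zero.2 h))
  filter_upwards [h1.eventually_gt_atTop 1] with n hn heq
  have h2 := Int.abs_sub_lt_one_of_floor_eq_floor (Equiv.intEquivNat.injective heq)
  rw [← mul_sub, abs_mul, abs_of_pos (by positivity)] at h2
  exact absurd hn (not_lt.2 h2.le)

theorem measurable_reindex_uncurry :
    Measurable fun p : (ℕ → ℕ) × MInfty => reindex p.1 p.2 := by
  refine Measurable.subtype_mk (measurable_pi_lambda _ fun i => measurable_pi_lambda _ fun j => ?_)
  have h : Measurable fun q : (ℕ × ℕ) × MInfty => q.2.1 q.1.1 q.1.2 :=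
    measurable_from_prod_countable_right fun q => measurable_entry q.1 q.2
  have h' : Measurable fun p : (ℕ → ℕ) × MInfty => ((p.1 i, p.1 j), p.2) := by fun_prop
  exact h.comp h'

/-- The matrix `d` read along the cells of a sequence of labels. -/
noncomputable def cellReindex (n : ℕ) (u : ℕ → ℝ) (d : MInfty) : MInfty :=
  reindex (fun i => cell n (u i)) d

theorem measurable_cellReindex (n : ℕ) :
    Measurable fun p : MInfty × (ℕ → ℝ) => cellReindex n p.2 p.1 := by
  have h : Measurable fun p : MInfty × (ℕ → ℝ) => ((fun i => cell n (p.2 i) : ℕ → ℕ), p.1) := by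
    fun_prop
  exact measurable_reindex_uncurry.comp h

/-- The integral of `f` against the law of `d` read along random labels. -/
noncomputable def cellMean (n : ℕ) (f : MInfty → ℝ) (d : MInfty) : ℝ :=
  ∫ u, f (cellReindex n u d) ∂labelSequence

theorem integrable_of_continuous {Ω : Type*} [MeasurableSpace Ω] {P : Measure Ω} [IsFiniteMeasure P]
    {f : MInfty → ℝ} (hf : Continuous f) {g : Ω → MInfty} (hg : Measurable g) :
    Integrable (fun ω => f (g ω)) P := by
  obtain ⟨C, hC⟩ := isCompact_univ.exists_bound_of_continuousOn hf.continuousOn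
  exact Integrable.of_bound (hf.measurable.comp hg).aestronglyMeasurable C
    (.of_forall fun d => hC _ (mem_univ _))

theorem integrable_cellMean {κ : Measure MInfty} [IsProbabilityMeasure κ] (n : ℕ) {f : MInfty → ℝ}
    (hf : Continuous f) : Integrable (cellMean n f) κ :=
  (integrable_of_continuous (P := κ.prod labelSequence) hf (measurable_cellReindex n)).integral_prod_left

theorem continuous_even_mul_odd {f : MInfty → ℝ} (hf : Continuous f) : Continuous fun d =>
    f (reindex (fun i => 2 * i) d) * f (reindex (fun i => 2 * i + 1) d) :=
  (hf.comp (continuous_reindex _)).mul (hf.comp (continuous_reindex _))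

/-- For a fixed matrix, the even and the odd labels are independent copies of the whole sequence, so
the square is again a mean, of a test function on two disjoint blocks. -/
theorem cellMean_sq (n : ℕ) {f : MInfty → ℝ} (hf : Continuous f) (d : MInfty) :
    cellMean n f d ^ 2 = cellMean n (fun d => f (reindex (fun i => 2 * i) d) *
      f (reindex (fun i => 2 * i + 1) d)) d := by
  have h := Measure.infinitePi_map_pair_of_injective (fun _ : ℕ => labelMeasure)
    (σ := fun i : ℕ => 2 * i) (τ := fun i : ℕ => 2 * i + 1) (fun a b h => by simpa using h)
    (fun a b h => by simpa using h) (fun i j => by omega)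
  calc cellMean n f d ^ 2
      = ∫ p, f (cellReindex n p.1 d) * f (cellReindex n p.2 d) ∂(labelSequence.prod labelSequence) := by
        rw [sq]
        exact (integral_prod_mul _ _).symm
    _ = _ := by
        have hc : ∀ g : (ℕ → ℝ) × (ℕ → ℝ) → ℕ → ℝ, Measurable g →
            Measurable fun p => f (cellReindex n (g p) d) := fun g hg =>
          hf.measurable.comp ((measurable_cellReindex n).comp (measurable_const.prodMk hg))
        rw [labelSequence, ← h, integral_map (by fun_prop)
          (by exact ((hc _ measurable_fst).mul (hc _ measurable_snd)).aestronglyMeasurable)]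
        rfl

namespace IsExchangeableDissociated

variable {κ : Measure MInfty} [IsProbabilityMeasure κ]

/-- By Fubini the labels can be fixed first. Almost surely they are distinct, hence eventually in
distinct cells, and the inner integral converges; dominated convergence finishes. -/
theorem tendsto_integral_cellMean (hκ : IsExchangeableDissociated κ) {f : MInfty → ℝ}
    (hf : Continuous f) :
    Tendsto (fun n => ∫ d, cellMean n f d ∂κ) atTop (𝓝 (∫ d, f d ∂κ)) := by
  have hswap : ∀ n, ∫ d, cellMean n f d ∂κ = ∫ u, ∫ d, f (cellReindex n u d) ∂κ ∂labelSequence :=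
    fun n => integral_integral_swap
      (integrable_of_continuous (P := κ.prod labelSequence) hf (measurable_cellReindex n))
  simp only [hswap]
  obtain ⟨C, hC⟩ := isCompact_univ.exists_bound_of_continuousOn hf.continuousOn
  have hlim : ∫ d, f d ∂κ = ∫ _u, ∫ d, f d ∂κ ∂labelSequence := by simp
  rw [hlim]
  refine tendsto_integral_of_dominated_convergence (fun _ => C) (fun n => ?_)
    (integrable_const C) (fun n => .of_forall fun u => ?_) ?_
  · exact (integrable_of_continuous (P := κ.prod labelSequence) hf
      (measurable_cellReindex n)).integral_prod_right.aestronglyMeasurable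
  · refine (norm_integral_le_of_norm_le_const (.of_forall fun d => hC _ (mem_univ _))).trans ?_
    simp
  · filter_upwards [Measure.ae_injective_infinitePi labelMeasure] with u hu
    exact hκ.tendsto_integral_reindex hf fun i j hij => eventually_cell_ne (hu.ne hij)

theorem integral_even_mul_odd (hκ : IsExchangeableDissociated κ) {f : MInfty → ℝ}
    (hf : Continuous f) :
    ∫ d, f (reindex (fun i => 2 * i) d) * f (reindex (fun i => 2 * i + 1) d) ∂κ
      = (∫ d, f d ∂κ) ^ 2 := by
  rw [sq, ← integral_prod_mul, ← hκ.map_even_odd, integral_map (by fun_prop)]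
  exact ((hf.comp continuous_fst).mul (hf.comp continuous_snd)).aestronglyMeasurable

theorem sq_cellMean_sub (n : ℕ) {f : MInfty → ℝ} (hf : Continuous f) (c : ℝ) (d : MInfty) :
    (cellMean n f d - c) ^ 2 = cellMean n (fun d => f (reindex (fun i => 2 * i) d) *
      f (reindex (fun i => 2 * i + 1) d)) d - 2 * c * cellMean n f d + c ^ 2 := by
  rw [← cellMean_sq n hf]
  ring

theorem integrable_sq_cellMean_sub (n : ℕ) {f : MInfty → ℝ} (hf : Continuous f) (c : ℝ) :
    Integrable (fun d => (cellMean n f d - c) ^ 2) κ := by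
  simp only [sq_cellMean_sub n hf]
  exact ((integrable_cellMean n (continuous_even_mul_odd hf)).sub
    ((integrable_cellMean n hf).const_mul _)).add (integrable_const _)

/-- Both the first moment and, by `cellMean_sq` and dissociation, the second moment converge to
those of the constant `∫ d, f d ∂κ`. -/
theorem tendsto_integral_sq_cellMean_sub (hκ : IsExchangeableDissociated κ) {f : MInfty → ℝ}
    (hf : Continuous f) :
    Tendsto (fun n => ∫ d, (cellMean n f d - ∫ d, f d ∂κ) ^ 2 ∂κ) atTop (𝓝 0) := by
  have h : ∀ (n : ℕ) (c : ℝ), ∫ d, (cellMean n f d - c) ^ 2 ∂κ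
      = (∫ d, cellMean n (fun d => f (reindex (fun i => 2 * i) d) *
        f (reindex (fun i => 2 * i + 1) d)) d ∂κ) - 2 * c * (∫ d, cellMean n f d ∂κ) + c ^ 2 := by
    intro n c
    have i1 := integrable_cellMean (κ := κ) n (continuous_even_mul_odd hf)
    have i2 := (integrable_cellMean (κ := κ) n hf).const_mul (2 * c)
    simp only [sq_cellMean_sub n hf]
    rw [integral_add (by exact i1.sub i2) (integrable_const _), integral_sub i1 i2,
      integral_const_mul]
    simp
  simp only [h]
  have h1 := hκ.tendsto_integral_cellMean (continuous_even_mul_odd hf)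
  rw [hκ.integral_even_mul_odd hf] at h1
  have h2 := (h1.sub ((hκ.tendsto_integral_cellMean hf).const_mul (2 * ∫ d, f d ∂κ))).add_const
    ((∫ d, f d ∂κ) ^ 2)
  convert h2 using 2
  ring

end IsExchangeableDissociated

/-- The index set of a matrix, without the metric of the natural numbers. -/
structure MatrixIndex : Type where
  val : ℕ

instance : Countable MatrixIndex :=
  Function.Injective.countable (f := MatrixIndex.val) fun ⟨_⟩ ⟨_⟩ h => congrArg _ h

/-- A semimetric on the natural numbers, read along the cells of random labels, is the sampling
measure of an mm-space. -/
theorem exists_mmSpace_tau_eq (n : ℕ) {d : MInfty}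
    (hd : ∀ i j k, (d.1 i k : ℝ) ≤ d.1 i j + d.1 j k) :
    ∃ Y : MMSpace, (Y.tau : Measure MInfty) = labelSequence.map fun u => cellReindex n u d := by
  let _ : PseudoMetricSpace MatrixIndex :=
    { dist := fun i j => (d.1 i.val j.val : ℝ)
      dist_self := fun i => by simp [d.2.2]
      dist_comm := fun i j => by rw [d.2.1]
      dist_triangle := fun i j k => hd i.val j.val k.val }
  -- The completion is Hausdorff, so it also identifies points at distance zero.
  let K := UniformSpace.Completion MatrixIndex
  let _ : MeasurableSpace K := borel K
  have _ : BorelSpace K := ⟨rfl⟩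
  let g : ℝ → K := fun u => ((⟨cell n u⟩ : MatrixIndex) : K)
  have hg : Measurable g := by
    have : Measurable fun m : ℕ => ((⟨m⟩ : MatrixIndex) : K) := measurable_of_countable _
    exact this.comp (measurable_cell n)
  have hprob : IsProbabilityMeasure (labelMeasure.map g) :=
    Measure.isProbabilityMeasure_map hg.aemeasurable
  have hsupp : (labelMeasure.map g).IsOpenPosMeasure := by
    refine ⟨fun U hU hne => ?_⟩
    obtain ⟨m, hm⟩ := UniformSpace.Completion.denseRange_coe.exists_mem_open hU hne
    rw [Measure.map_apply hg hU.measurableSet]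
    let z : ℤ := Equiv.intEquivNat.symm m.val
    have hn : (0 : ℝ) < n + 1 := by positivity
    -- Full support: an open set contains the image of some index `m`, whose cell contains an
    -- interval, and the Gaussian charges every interval.
    have hsub : Ioo ((z : ℝ) / (n + 1)) ((z + 1) / (n + 1)) ⊆ g ⁻¹' U := by
      intro u hu
      have h1 : ⌊((n : ℝ) + 1) * u⌋ = z := by
        rw [Int.floor_eq_iff]
        rw [mem_Ioo, div_lt_iff₀' hn, lt_div_iff₀' hn] at hu
        exact ⟨hu.1.le, hu.2⟩
      have h2 : cell n u = m.val := by rw [cell, h1]; exact Equiv.apply_symm_apply _ _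
      change ((⟨cell n u⟩ : MatrixIndex) : K) ∈ U
      rw [h2]
      exact hm
    intro h0
    have h1 := gaussianReal_absolutelyContinuous' 0 (one_ne_zero) (measure_mono_null hsub h0)
    rw [Real.volume_Ioo, ENNReal.ofReal_eq_zero, sub_nonpos,
      div_le_div_iff_of_pos_right hn] at h1
    linarith
  let Y : MMSpace :=
    { carrier := K
      dist_le_one := fun x y => by
        refine UniformSpace.Completion.induction_on₂ x y
          (isClosed_le continuous_dist continuous_const) fun i j => ?_
        rw [UniformSpace.Completion.dist_eq]
        exact (d.1 i.val j.val).2.2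
      μ := labelMeasure.map g }
  refine ⟨Y, ?_⟩
  change (Measure.infinitePi fun _ : ℕ => labelMeasure.map g).map Y.rho = _
  rw [← Measure.infinitePi_map_pi (fun _ : ℕ => labelMeasure) (fun _ => hg),
    Measure.map_map Y.measurable_rho (by fun_prop)]
  congr 1
  funext u
  refine Subtype.ext (funext fun i => funext fun j => Subtype.ext ?_)
  exact UniformSpace.Completion.dist_eq (⟨cell n (u i)⟩ : MatrixIndex) ⟨cell n (u j)⟩

namespace IsExchangeableDissociated

/-- The sum of the squared errors has small mean, so outside the null set of non-semimetrics some
matrix has a sum no larger than that mean; each single error is then small. -/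
theorem exists_mmSpace_integral_near {κ : Measure MInfty} [IsProbabilityMeasure κ]
    (hκ : IsExchangeableDissociated κ) (s : Finset (MInfty →ᵇ ℝ)) {ε : ℝ} (hε : 0 < ε) :
    ∃ Y : MMSpace, ∀ f ∈ s, |∫ d, f d ∂(Y.tau : Measure MInfty) - ∫ d, f d ∂κ| < ε := by
  have hlim : Tendsto (fun n => ∫ d, ∑ f ∈ s, (cellMean n f d - ∫ d, f d ∂κ) ^ 2 ∂κ) atTop
      (𝓝 0) := by
    have h : ∀ n, ∫ d, ∑ f ∈ s, (cellMean n f d - ∫ d, f d ∂κ) ^ 2 ∂κ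
        = ∑ f ∈ s, ∫ d, (cellMean n f d - ∫ d, f d ∂κ) ^ 2 ∂κ := fun n =>
      integral_finsetSum s fun f _ => integrable_sq_cellMean_sub n f.continuous _
    simp only [h]
    simpa using tendsto_finsetSum s fun f _ => hκ.tendsto_integral_sq_cellMean_sub f.continuous
  obtain ⟨n, hn⟩ := (hlim.eventually (gt_mem_nhds (pow_pos hε 2))).exists
  obtain ⟨d, hd, hdn⟩ := exists_notMem_null_le_integral
    (integrable_finsetSum s fun f _ =>
      integrable_sq_cellMean_sub (κ := κ) n f.continuous (∫ d, f d ∂κ)) (ae_iff.1 hκ.ae_triangle)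
  simp only [mem_ofPred_eq, not_not] at hd
  obtain ⟨Y, hY⟩ := exists_mmSpace_tau_eq n hd
  refine ⟨Y, fun f hf => ?_⟩
  have hm : Measurable fun u => cellReindex n u d :=
    (measurable_cellReindex n).comp (measurable_const.prodMk measurable_id)
  rw [hY, integral_map hm.aemeasurable f.continuous.aestronglyMeasurable]
  refine abs_lt_of_sq_lt_sq ?_ hε.le
  refine lt_of_le_of_lt ?_ (hdn.trans_lt hn)
  exact Finset.single_le_sum (f := fun f : MInfty →ᵇ ℝ => (cellMean n f d - ∫ d, f d ∂κ) ^ 2)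
    (fun _ _ => sq_nonneg _) hf

/-- Exchangeable dissociated random semimetrics are limits of samples from mm-spaces. -/
theorem mem_chiBar {κ : ProbabilityMeasure MInfty}
    (hκ : IsExchangeableDissociated (κ : Measure MInfty)) : κ ∈ chiBar := by
  classical
  choose Y hY using fun q : Finset (MInfty →ᵇ ℝ) × ℕ =>
    hκ.exists_mmSpace_integral_near q.1 (Nat.one_div_pos_of_nat (α := ℝ) (n := q.2))
  -- The net runs over finite sets of test functions paired with precisions.
  refine mem_closure_of_tendsto (f := fun q => (Y q).tau) (b := atTop) ?_
    (.of_forall fun q => mem_range_self _)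
  rw [ProbabilityMeasure.tendsto_iff_forall_integral_tendsto]
  intro f
  rw [Metric.tendsto_nhds]
  intro ε hε
  obtain ⟨m, hm⟩ := exists_nat_one_div_lt hε
  filter_upwards [eventually_ge_atTop (({f} : Finset (MInfty →ᵇ ℝ)), m)] with q hq
  have h1 := hY q f (hq.1 (Finset.mem_singleton_self f))
  rw [Real.dist_eq]
  exact h1.trans ((Nat.one_div_le_one_div hq.2).trans_lt hm)

end IsExchangeableDissociated

/-! ### Representation by reference points -/

/-- A kernel that is a conditional law of a variable invariant under an involution of the
conditioning variable can be chosen invariant. -/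
theorem exists_invariant_condKernel {Ω V Y : Type*} [MeasurableSpace Ω] [MeasurableSpace V]
    [MeasurableSpace Y] [StandardBorelSpace Y] [Nonempty Y] {P : Measure Ω} [IsProbabilityMeasure P]
    {η : Ω → V} {ξ : Ω → Y} (hη : Measurable η) (hξ : Measurable ξ) {s : V → V} (hs : Measurable s)
    (hss : ∀ v, s (s v) = v)
    (hlaw : P.map (fun ω => (s (η ω), ξ ω)) = P.map (fun ω => (η ω, ξ ω))) :
    ∃ k : Kernel V Y, IsMarkovKernel k ∧ (∀ v, k (s v) = k v) ∧
      P.map (fun ω => (η ω, ξ ω)) = P.map η ⊗ₘ k := by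
  let k₀ : Kernel V Y := condDistrib ξ η P
  have hk₀ : P.map (fun ω => (η ω, ξ ω)) = P.map η ⊗ₘ k₀ :=
    (compProd_map_condDistrib hξ.aemeasurable).symm
  -- An arbitrary conditional law averaged with its transform under `s`; by the assumed invariance
  -- both halves disintegrate the same joint law.
  let k : Kernel V Y :=
    { toFun := fun v => (2⁻¹ : ENNReal) • (k₀ v + k₀ (s v))
      measurable' := by
        refine Measure.measurable_of_measurable_coe _ fun T hT => ?_
        have h := k₀.measurable_coe hT
        exact (h.add (h.comp hs)).const_mul _ }
  have hk : ∀ v T, k v T = 2⁻¹ * (k₀ v T + k₀ (s v) T) := fun v T => rfl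
  have hM : IsMarkovKernel k := ⟨fun v => ⟨by
    rw [hk, measure_univ, measure_univ, one_add_one_eq_two]
    exact ENNReal.inv_mul_cancel two_ne_zero ENNReal.ofNat_ne_top⟩⟩
  have hlaw1 : P.map (fun ω => s (η ω)) = P.map η := by
    have := congrArg (Measure.map Prod.fst) hlaw
    rwa [Measure.map_map measurable_fst (by fun_prop),
      Measure.map_map measurable_fst (by fun_prop)] at this
  refine ⟨k, hM, fun v => ?_, ?_⟩
  · ext T hT
    rw [hk, hk, hss, add_comm]
  · refine Measure.ext_prod fun {A T} hA hT => ?_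
    have hsA : MeasurableSet (s ⁻¹' A) := hs hA
    have hm := k₀.measurable_coe hT
    have hms : Measurable fun v => k₀ (s v) T := hm.comp hs
    have e1 : P.map (fun ω => (η ω, ξ ω)) (A ×ˢ T) = ∫⁻ v in A, k₀ v T ∂(P.map η) := by
      rw [hk₀, Measure.compProd_apply_prod hA hT]
    have e2 : P.map (fun ω => (η ω, ξ ω)) (A ×ˢ T) = ∫⁻ v in A, k₀ (s v) T ∂(P.map η) := by
      have h1 : P.map (fun ω => (η ω, ξ ω)) (A ×ˢ T)
          = P.map (fun ω => (η ω, ξ ω)) ((s ⁻¹' A) ×ˢ T) := by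
        conv_lhs => rw [← hlaw]
        rw [Measure.map_apply (by fun_prop) (hA.prod hT),
          Measure.map_apply (by fun_prop) (hsA.prod hT)]
        rfl
      have h2 : (P.map η).map s = P.map η := by
        rw [Measure.map_map hs hη]
        exact hlaw1
      rw [h1, hk₀, Measure.compProd_apply_prod hsA hT]
      conv_rhs => rw [← h2, setLIntegral_map hA hms hs]
      simp only [hss]
    rw [Measure.compProd_apply_prod hA hT]
    simp only [hk]
    rw [lintegral_const_mul _ (by fun_prop), lintegral_add_left hm, ← e1, ← e2, ← two_mul,
      ← mul_assoc, ENNReal.inv_mul_cancel two_ne_zero ENNReal.ofNat_ne_top, one_mul]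

/-- The submatrix of `d` along `φ`. -/
def subarray {A : Type*} (φ : A → ℕ) (d : MInfty) : A → A → unitInterval :=
  fun a b => d.1 (φ a) (φ b)

theorem measurable_subarray {A : Type*} (φ : A → ℕ) : Measurable (subarray φ) :=
  measurable_pi_lambda _ fun _ => measurable_pi_lambda _ fun _ => measurable_entry _ _

/-- The entries above the diagonal. -/
def upperEntries (d : MInfty) : UpperPair → unitInterval := fun p => d.1 p.1.1 p.1.2

theorem measurable_upperEntries : Measurable upperEntries :=
  measurable_pi_lambda _ fun _ => measurable_entry _ _

theorem symmFill_upperEntries (d : MInfty) : symmFill (upperEntries d) = d := by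
  refine Subtype.ext (funext fun i => funext fun j => ?_)
  rcases lt_trichotomy i j with h | rfl | h
  · simp [symmFill, upperEntries, h]
  · simp [symmFill, d.2.2]
  · simp [symmFill, upperEntries, h, h.not_gt, d.2.1 j i]

/-- The indices of the reference points. -/
def refIndex : ℕ ⊕ ℕ → ℕ := Sum.elim (fun g => 3 * g + 1) fun g => 3 * g + 2

theorem refIndex_injective : Function.Injective refIndex := by
  rintro (a | a) (b | b) h <;> simp only [refIndex, Sum.elim_inl, Sum.elim_inr] at h
  · exact congrArg _ (by omega)
  · omega
  · omega
  · exact congrArg _ (by omega)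

/-- The distances of the `n`-th sample point to the reference points of the first kind. -/
def refRow (n : ℕ) (d : MInfty) : ℕ → unitInterval := fun g => d.1 (3 * n) (3 * g + 1)

theorem measurable_refRow (n : ℕ) : Measurable (refRow n) :=
  measurable_pi_lambda _ fun _ => measurable_entry _ _

/-- The submatrix along `ψ` together with the rows of `s` and `t` along `ψ`. -/
def pairView (s t : ℕ) (ψ : ℕ → ℕ) (d : MInfty) :
    (ℕ → ℕ → unitInterval) × (ℕ → unitInterval) × (ℕ → unitInterval) :=
  (subarray ψ d, fun g => d.1 s (ψ g), fun g => d.1 t (ψ g))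

theorem measurable_pairView (s t : ℕ) (ψ : ℕ → ℕ) : Measurable (pairView s t ψ) :=
  (measurable_subarray ψ).prodMk ((measurable_pi_lambda _ fun _ => measurable_entry _ _).prodMk
    (measurable_pi_lambda _ fun _ => measurable_entry _ _))

/-- The part of the reference data that the law of a single length depends on. -/
def pairData (p : UpperPair) (z : (ℕ ⊕ ℕ → ℕ ⊕ ℕ → unitInterval) × (ℕ → ℕ → unitInterval)) :
    (ℕ → ℕ → unitInterval) × (ℕ → unitInterval) × (ℕ → unitInterval) :=
  (fun g g' => z.1 (Sum.inl g) (Sum.inl g'), z.2 p.1.1, z.2 p.1.2)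

theorem measurable_pairData (p : UpperPair) : Measurable (pairData p) := by
  unfold pairData
  fun_prop

namespace IsExchangeableDissociated

variable {κ : Measure MInfty}

/-- Exchangeability in index-free form: `A` is countably infinite, so a bijection with the naturals
turns any injection into an injective reindexing. -/
theorem map_subarray_eq (hκ : IsExchangeableDissociated κ) {A : Type*} [Countable A] [Infinite A]
    {φ φ' : A → ℕ} (hφ : Function.Injective φ) (hφ' : Function.Injective φ') :
    κ.map (subarray φ) = κ.map (subarray φ') := by
  obtain ⟨e⟩ : Nonempty (A ≃ ℕ) := nonempty_equiv_of_countable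
  have h : ∀ {φ : A → ℕ}, Function.Injective φ → κ.map (subarray φ) = κ.map (subarray e) := by
    intro φ hφ
    conv_rhs => rw [← hκ.map_reindex (φ ∘ e.symm) (hφ.comp e.symm.injective)]
    rw [Measure.map_map (measurable_subarray _) (measurable_reindex _)]
    congr 1
    funext d a b
    simp [subarray, reindex]
  rw [h hφ, h hφ']

theorem map_subarray_row_eq (hκ : IsExchangeableDissociated κ) {m n : ℕ} {φ φ' : ℕ ⊕ ℕ → ℕ}
    (hφ : Function.Injective φ) (hφ' : Function.Injective φ') (hm : ∀ x, φ x ≠ m)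
    (hn : ∀ x, φ' x ≠ n) :
    κ.map (fun d => (subarray φ d, fun g : ℕ => d.1 m (φ (Sum.inl g))))
      = κ.map (fun d => (subarray φ' d, fun g : ℕ => d.1 n (φ' (Sum.inl g)))) := by
  let F : (Option (ℕ ⊕ ℕ) → Option (ℕ ⊕ ℕ) → unitInterval) →
      (ℕ ⊕ ℕ → ℕ ⊕ ℕ → unitInterval) × (ℕ → unitInterval) := fun B =>
    (fun x y => B (some x) (some y), fun g => B none (some (Sum.inl g)))
  have hF : Measurable F := by fun_prop
  have hinj : ∀ {m : ℕ} {φ : ℕ ⊕ ℕ → ℕ}, Function.Injective φ → (∀ x, φ x ≠ m) →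
      Function.Injective fun o : Option (ℕ ⊕ ℕ) => o.elim m φ := by
    rintro m φ hφ hm (_ | x) (_ | y) h
    · rfl
    · exact absurd h.symm (hm y)
    · exact absurd h (hm x)
    · exact congrArg some (hφ h)
  have h := congrArg (Measure.map F) (hκ.map_subarray_eq (hinj hφ hm) (hinj hφ' hn))
  rwa [Measure.map_map hF (measurable_subarray _), Measure.map_map hF (measurable_subarray _)] at h

theorem map_pairView_eq (hκ : IsExchangeableDissociated κ) {s t s' t' : ℕ} {ψ ψ' : ℕ → ℕ}
    (hψ : Function.Injective ψ) (hψ' : Function.Injective ψ') (hst : s ≠ t) (hst' : s' ≠ t')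
    (hs : ∀ x, ψ x ≠ s) (ht : ∀ x, ψ x ≠ t) (hs' : ∀ x, ψ' x ≠ s') (ht' : ∀ x, ψ' x ≠ t') :
    κ.map (fun d => (pairView s t ψ d, d.1 s t)) = κ.map (fun d => (pairView s' t' ψ' d, d.1 s' t')) := by
  let F : (Bool ⊕ ℕ → Bool ⊕ ℕ → unitInterval) →
      ((ℕ → ℕ → unitInterval) × (ℕ → unitInterval) × (ℕ → unitInterval)) × unitInterval := fun B =>
    ((fun x y => B (Sum.inr x) (Sum.inr y), fun g => B (Sum.inl true) (Sum.inr g),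
      fun g => B (Sum.inl false) (Sum.inr g)), B (Sum.inl true) (Sum.inl false))
  have hF : Measurable F := by fun_prop
  have hinj : ∀ {s t : ℕ} {ψ : ℕ → ℕ}, Function.Injective ψ → s ≠ t → (∀ x, ψ x ≠ s) →
      (∀ x, ψ x ≠ t) → Function.Injective (Sum.elim (fun b : Bool => if b then s else t) ψ) := by
    intro s t ψ hψ hst hs ht
    refine Function.Injective.sumElim ?_ hψ ?_
    · rintro (_ | _) (_ | _) h <;> simp_all [eq_comm]
    · rintro (_ | _) x <;> simp [(hs x).symm, (ht x).symm]
  have h := congrArg (Measure.map F)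
    (hκ.map_subarray_eq (hinj hψ hst hs ht) (hinj hψ' hst' hs' ht'))
  rwa [Measure.map_map hF (measurable_subarray _), Measure.map_map hF (measurable_subarray _)] at h

variable [IsProbabilityMeasure κ]

/-- Given the reference matrix, the rows of the sample points are independent with the same law. -/
theorem exists_rowKernel (hκ : IsExchangeableDissociated κ) :
    ∃ k : Kernel (ℕ ⊕ ℕ → ℕ ⊕ ℕ → unitInterval) (ℕ → unitInterval), ∃ _ : IsMarkovKernel k,
      κ.map (fun d => (subarray refIndex d, fun n => refRow n d))
        = κ.map (subarray refIndex) ⊗ₘ Kernel.infinitePi fun _ : ℕ => k := by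
  have hne : ∀ n x, refIndex x ≠ 3 * n := by
    rintro n (x | x) <;> simp only [refIndex, Sum.elim_inl, Sum.elim_inr] <;> omega
  refine ⟨condDistrib (refRow 0) (subarray refIndex) κ, inferInstance,
    map_prodMk_eq_compProd_infinitePi (measurable_subarray _) measurable_refRow fun n => ?_⟩
  -- References of the first kind stay in place, while the second kind is traded for all remaining
  -- indices except `3 * n`. The enlarged matrix then sees every entry off the index `3 * n`, yet
  -- has the same joint law with the row as the reference matrix does. Rows omit the second kind to
  -- leave this room.
  obtain ⟨e⟩ : Nonempty (ℕ ≃ {m : ℕ // m % 3 ≠ 1 ∧ m ≠ 3 * n}) := by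
    have : Infinite {m : ℕ // m % 3 ≠ 1 ∧ m ≠ 3 * n} :=
      Infinite.of_injective (fun g : ℕ => ⟨3 * g + 2, by omega⟩) fun a b h => by
        simpa using h
    exact nonempty_equiv_of_countable
  let φ : ℕ ⊕ ℕ → ℕ := Sum.elim (fun g => 3 * g + 1) fun g => (e g).1
  have hφ : Function.Injective φ := by
    refine Function.Injective.sumElim (fun a b h => by simpa using h)
      (fun a b h => e.injective (Subtype.ext h)) fun a b h => ?_
    have := (e b).2.1
    omega
  have hφn : ∀ x, φ x ≠ 3 * n := by
    rintro (x | x)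
    · simp only [φ, Sum.elim_inl]; omega
    · exact (e x).2.2
  have hsurj : ∀ m, m ≠ 3 * n → ∃ x, φ x = m := by
    intro m hm
    by_cases h1 : m % 3 = 1
    · exact ⟨Sum.inl (m / 3), by simp only [φ, Sum.elim_inl]; omega⟩
    · exact ⟨Sum.inr (e.symm ⟨m, h1, hm⟩), by simp [φ]⟩
  have hentry : ∀ l m, l ≠ 3 * n → m ≠ 3 * n →
      Measurable[MeasurableSpace.comap (subarray φ) inferInstance] fun d : MInfty => d.1 l m := by
    intro l m hl hm
    obtain ⟨x, rfl⟩ := hsurj l hl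
    obtain ⟨y, rfl⟩ := hsurj m hm
    exact ((measurable_pi_apply y).comp (measurable_pi_apply x)).comp
      (comap_measurable (subarray φ))
  have href : Measurable[MeasurableSpace.comap (subarray φ) inferInstance] (subarray refIndex) :=
    @measurable_pi_lambda _ _ _ (_) _ _ fun x => @measurable_pi_lambda _ _ _ (_) _ _ fun y =>
      hentry _ _ (hne n x) (hne n y)
  refine ⟨MeasurableSpace.comap (subarray φ) inferInstance, href, fun m hm => ?_, fun W S hW hS => ?_⟩
  · exact @measurable_pi_lambda _ _ _ (_) _ _ fun g => hentry _ _ (by omega) (by omega)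
  · refine lintegral_mul_indicator_of_map_eq (measurable_subarray _) (measurable_subarray φ)
      (measurable_refRow n) ?_ ?_ href hW hS
    · rw [compProd_map_condDistrib (measurable_refRow 0).aemeasurable]
      exact hκ.map_subarray_row_eq refIndex_injective refIndex_injective (hne n) (hne 0)
    · exact hκ.map_subarray_row_eq hφ refIndex_injective hφn (hne n)

/-- Given the reference matrix and the rows of the sample points, the distances of the sample points
are independent, and the law of each depends on the rows of its two points only. -/
theorem exists_lengthKernel (hκ : IsExchangeableDissociated κ) :
    ∃ q : Kernel ((ℕ → ℕ → unitInterval) × (ℕ → unitInterval) × (ℕ → unitInterval)) unitInterval,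
      ∃ _ : IsMarkovKernel q, (∀ D x y, q (D, x, y) = q (D, y, x)) ∧
      κ.map (fun d => ((subarray refIndex d, fun n => refRow n d),
          upperEntries (reindex (fun i => 3 * i) d)))
        = κ.map (fun d => (subarray refIndex d, fun n => refRow n d)) ⊗ₘ
          Kernel.infinitePi fun p : UpperPair => q.comap (pairData p) (measurable_pairData p) := by
  let a : ℕ → ℕ := fun g => 3 * g + 1
  have ha : Function.Injective a := fun x y h => by simpa [a] using h
  have hane : ∀ n x, a x ≠ 3 * n := fun n x => by simp only [a]; omega
  -- Indices 0 and 3 are the sample points number 0 and 1. Exchanging them swaps their rows and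
  -- keeps their distance, so the kernel can be chosen symmetric.
  obtain ⟨q, hqM, hqs, hq⟩ := exists_invariant_condKernel (P := κ) (measurable_pairView 0 3 a)
    (measurable_entry 0 3) (s := fun v => (v.1, v.2.2, v.2.1)) (by fun_prop) (fun v => rfl) (by
      have h := hκ.map_pairView_eq (s := 3) (t := 0) (s' := 0) (t' := 3) ha ha (by decide)
        (by decide) (hane 1) (hane 0) (hane 0) (hane 1)
      refine Eq.trans ?_ h
      congr 1
      funext d
      exact Prod.ext rfl (d.2.1 0 3))
  refine ⟨q, hqM, fun D x y => hqs (D, y, x), ?_⟩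
  have hZ : Measurable fun d : MInfty => (subarray refIndex d, fun n => refRow n d) :=
    (measurable_subarray _).prodMk (measurable_pi_lambda _ measurable_refRow)
  refine map_prodMk_eq_compProd_infinitePi hZ (fun p => measurable_entry _ _) fun p => ?_
  have hp := p.2
  obtain ⟨e⟩ : Nonempty (ℕ ≃ {m : ℕ // m ≠ 3 * p.1.1 ∧ m ≠ 3 * p.1.2}) := by
    have : Infinite {m : ℕ // m ≠ 3 * p.1.1 ∧ m ≠ 3 * p.1.2} :=
      Infinite.of_injective (fun g : ℕ => ⟨3 * g + 2, by omega⟩) fun a b h => by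
        simpa using h
    exact nonempty_equiv_of_countable
  -- The enlarged view takes as references all indices other than the two of `p`: it determines the
  -- reference data and all other lengths, and has the same joint law with the length of `p` as the
  -- view along `a`.
  let ψ : ℕ → ℕ := fun g => (e g).1
  have hψ : Function.Injective ψ := fun a b h => e.injective (Subtype.ext h)
  let η' := pairView (3 * p.1.1) (3 * p.1.2) ψ
  have hrow : ∀ l m, (l = 3 * p.1.1 ∨ l = 3 * p.1.2) → m ≠ 3 * p.1.1 → m ≠ 3 * p.1.2 →
      Measurable[MeasurableSpace.comap η' inferInstance] fun d : MInfty => d.1 l m := by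
    intro l m hl hm hm'
    have hψm : ψ (e.symm ⟨m, hm, hm'⟩) = m := by simp [ψ]
    rcases hl with rfl | rfl
    · rw [← hψm]
      exact ((measurable_pi_apply _).comp (measurable_fst.comp measurable_snd)).comp
        (comap_measurable η')
    · rw [← hψm]
      exact ((measurable_pi_apply _).comp (measurable_snd.comp measurable_snd)).comp
        (comap_measurable η')
  have hentry : ∀ l m, ¬ ((l = 3 * p.1.1 ∨ l = 3 * p.1.2) ∧ (m = 3 * p.1.1 ∨ m = 3 * p.1.2)) →
      Measurable[MeasurableSpace.comap η' inferInstance] fun d : MInfty => d.1 l m := by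
    intro l m hlm
    by_cases hl : l = 3 * p.1.1 ∨ l = 3 * p.1.2
    · exact hrow l m hl (fun h => hlm ⟨hl, Or.inl h⟩) fun h => hlm ⟨hl, Or.inr h⟩
    by_cases hm : m = 3 * p.1.1 ∨ m = 3 * p.1.2
    · have : (fun d : MInfty => d.1 l m) = fun d => d.1 m l := funext fun d => d.2.1 l m
      rw [this]
      exact hrow m l hm (fun h => hl (Or.inl h)) fun h => hl (Or.inr h)
    · push Not at hl hm
      have h1 : ψ (e.symm ⟨l, hl⟩) = l := by simp [ψ]
      have h2 : ψ (e.symm ⟨m, hm⟩) = m := by simp [ψ]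
      rw [← h1, ← h2]
      exact ((measurable_pi_apply _).comp ((measurable_pi_apply _).comp measurable_fst)).comp
        (comap_measurable η')
  have hrow' : ∀ n, Measurable[MeasurableSpace.comap η' inferInstance] (refRow n) := fun n =>
    @measurable_pi_lambda _ _ _ (_) _ _ fun g => hentry _ _ (by omega)
  have href : Measurable[MeasurableSpace.comap η' inferInstance] (subarray refIndex) :=
    @measurable_pi_lambda _ _ _ (_) _ _ fun x => @measurable_pi_lambda _ _ _ (_) _ _ fun y =>
      hentry _ _ (by rcases x with x | x <;> simp only [refIndex, Sum.elim_inl, Sum.elim_inr] <;> omega)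
  have hZ' : Measurable[MeasurableSpace.comap η' inferInstance]
      fun d : MInfty => (subarray refIndex d, fun n => refRow n d) :=
    @Measurable.prodMk _ _ _ _ _ (_) _ _ href (@measurable_pi_lambda _ _ _ (_) _ _ hrow')
  refine ⟨MeasurableSpace.comap η' inferInstance, hZ', fun r hr => ?_, fun W S hW hS => ?_⟩
  · refine hentry (3 * r.1.1) (3 * r.1.2) fun h => hr (Subtype.ext (Prod.ext ?_ ?_))
    all_goals
      have := r.2
      omega
  · have hη : pairView (3 * p.1.1) (3 * p.1.2) a
        = fun d => pairData p (subarray refIndex d, fun n => refRow n d) := rfl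
    have hpne : 3 * p.1.1 ≠ 3 * p.1.2 := by omega
    have h := lintegral_mul_indicator_of_map_eq (P := κ) (k := q)
      (measurable_pairView (3 * p.1.1) (3 * p.1.2) a) (measurable_pairView _ _ ψ)
      (measurable_entry (3 * p.1.1) (3 * p.1.2)) ?_ ?_ ?_ hW hS
    · exact h
    · have h1 := hκ.map_pairView_eq (s := 3 * p.1.1) (t := 3 * p.1.2) (s' := 0) (t' := 3) ha ha
        hpne (by decide) (hane _) (hane _) (hane 0) (hane 1)
      have h2 := congrArg (Measure.map Prod.fst) h1
      rw [Measure.map_map measurable_fst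
          ((measurable_pairView _ _ _).prodMk (measurable_entry _ _)),
        Measure.map_map measurable_fst
          ((measurable_pairView _ _ _).prodMk (measurable_entry _ _))] at h2
      rw [h1, hq]
      exact congrArg (· ⊗ₘ q) h2.symm
    · exact hκ.map_pairView_eq hψ ha hpne hpne (fun x => (e x).2.1) (fun x => (e x).2.2)
        (hane _) (hane _)
    · rw [hη]
      exact (measurable_pairData p).comp hZ'

/-- The sample points are independent of the reference points. -/
theorem map_subarray_upperEntries (hκ : IsExchangeableDissociated κ) :
    κ.map (fun d => (subarray refIndex d, upperEntries (reindex (fun i => 3 * i) d)))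
      = (κ.map (subarray refIndex)).prod (κ.map upperEntries) := by
  let e : ℕ ⊕ ℕ ≃ ℕ := Equiv.natSumNatEquivNat
  -- Even indices go to sample points and odd ones to reference points, so independence of the even
  -- and odd blocks becomes the claim.
  let σ : ℕ → ℕ := fun n => if n % 2 = 0 then 3 * (n / 2) else refIndex (e.symm (n / 2))
  have hσ : Function.Injective σ := by
    have hne : ∀ n x, 3 * n ≠ refIndex x := by
      rintro n (x | x) <;> simp only [refIndex, Sum.elim_inl, Sum.elim_inr] <;> omega
    intro m n h
    simp only [σ] at h
    split_ifs at h with hm hn hn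
    · omega
    · exact absurd h (hne _ _)
    · exact absurd h.symm (hne _ _)
    · have := e.symm.injective (refIndex_injective h)
      omega
  have hσ0 : ∀ i, σ (2 * i) = 3 * i := fun i => by simp [σ]
  have hσ1 : ∀ i, σ (2 * i + 1) = refIndex (e.symm i) := fun i => by
    have h1 : (2 * i + 1) % 2 = 1 := by omega
    have h2 : (2 * i + 1) / 2 = i := by omega
    simp [σ, h1, h2]
  let G : MInfty × MInfty → (ℕ ⊕ ℕ → ℕ ⊕ ℕ → unitInterval) × (UpperPair → unitInterval) :=
    fun p => (subarray e p.2, upperEntries p.1)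
  have hG : Measurable G := ((measurable_subarray _).comp measurable_snd).prodMk
    (measurable_upperEntries.comp measurable_fst)
  have h1 : κ.map (fun d => (subarray refIndex d, upperEntries (reindex (fun i => 3 * i) d)))
      = (κ.prod κ).map G := by
    conv_rhs => rw [← hκ.map_even_odd, ← hκ.map_reindex σ hσ]
    rw [Measure.map_map hG (by fun_prop), Measure.map_map (hG.comp (by fun_prop)) (by fun_prop)]
    congr 1
    funext d
    refine Prod.ext (funext fun x => funext fun y => ?_) (funext fun p => ?_)
    · simp [G, subarray, reindex, hσ1]
    · simp [G, upperEntries, reindex, hσ0]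
  have h2 : κ.map (subarray refIndex) = κ.map (subarray e) :=
    hκ.map_subarray_eq refIndex_injective e.injective
  rw [h1, h2, Measure.map_prod_map _ _ (measurable_subarray _) measurable_upperEntries]
  conv_lhs => rw [← Measure.prod_swap, Measure.map_map hG measurable_swap]
  rfl

/-- Some reference matrix gives the data of a qmm-space whose entries have the law prescribed
by `κ`. -/
theorem exists_entries (hκ : IsExchangeableDissociated κ) :
    ∃ (ν : Measure (ℕ → unitInterval)) (q : Kernel ((ℕ → unitInterval) × (ℕ → unitInterval))
      unitInterval), ∃ _ : IsProbabilityMeasure ν, ∃ _ : IsMarkovKernel q,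
      (∀ x y, q (x, y) = q (y, x)) ∧
      (Measure.infinitePi fun _ : ℕ => ν).bind (fun x =>
        Measure.infinitePi fun p : UpperPair => q (x p.1.1, x p.1.2)) = κ.map upperEntries := by
  obtain ⟨k, hkM, hk⟩ := hκ.exists_rowKernel
  obtain ⟨q, hqM, hqs, hq⟩ := hκ.exists_lengthKernel
  let K₁ := Kernel.infinitePi fun _ : ℕ => k
  let K₂ := Kernel.infinitePi fun p : UpperPair => q.comap (pairData p) (measurable_pairData p)
  have hE : Measurable fun d => upperEntries (reindex (fun i => 3 * i) d) :=
    measurable_upperEntries.comp (measurable_reindex _)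
  have hZ : Measurable fun d : MInfty => (subarray refIndex d, fun n => refRow n d) :=
    (measurable_subarray _).prodMk (measurable_pi_lambda _ measurable_refRow)
  have hup := Measure.isProbabilityMeasure_map (μ := κ) measurable_upperEntries.aemeasurable
  have hsub := Measure.isProbabilityMeasure_map (μ := κ) (measurable_subarray refIndex).aemeasurable
  -- Two disintegrations of the joint law of reference matrix and sample entries: through the rows
  -- on the left, by independence on the right.
  have hmain : κ.map (subarray refIndex) ⊗ₘ Kernel.snd (K₁ ⊗ₖ K₂)
      = κ.map (subarray refIndex) ⊗ₘ Kernel.const _ (κ.map upperEntries) := by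
    rw [Measure.compProd_const, ← hκ.map_subarray_upperEntries]
    refine Measure.ext_prod fun {A B} hA hB => ?_
    have h1 : κ.map (fun d => (subarray refIndex d, upperEntries (reindex (fun i => 3 * i) d)))
          (A ×ˢ B)
        = κ.map (fun d => ((subarray refIndex d, fun n => refRow n d),
            upperEntries (reindex (fun i => 3 * i) d))) ((A ×ˢ univ) ×ˢ B) := by
      rw [Measure.map_apply ((measurable_subarray _).prodMk hE) (hA.prod hB),
        Measure.map_apply (hZ.prodMk hE) ((hA.prod .univ).prod hB)]
      congr 1
      ext d
      simp
    rw [h1, hq, Measure.compProd_apply_prod (hA.prod .univ) hB, hk,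
      Measure.setLIntegral_compProd (K₂.measurable_coe hB) hA .univ,
      Measure.compProd_apply_prod hA hB]
    refine lintegral_congr fun D => ?_
    rw [Kernel.snd_apply' _ _ hB, Kernel.compProd_apply (measurable_snd hB), Measure.restrict_univ]
    rfl
  -- Disintegrations are almost everywhere unique, so for some fixed reference matrix `D` the two
  -- kernels agree.
  obtain ⟨D, hD⟩ := (Kernel.ae_eq_of_compProd_eq hmain).exists
  let f : (ℕ → unitInterval) × (ℕ → unitInterval) →
      (ℕ → ℕ → unitInterval) × (ℕ → unitInterval) × (ℕ → unitInterval) := fun v =>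
    (fun g g' => D (Sum.inl g) (Sum.inl g'), v.1, v.2)
  have hf : Measurable f := by fun_prop
  refine ⟨k D, q.comap f hf, inferInstance, inferInstance, fun x y => hqs _ x y, ?_⟩
  rw [Kernel.const_apply] at hD
  rw [← hD]
  ext B hB
  have hm : Measurable fun x : ℕ → ℕ → unitInterval => K₂ (D, x) :=
    K₂.measurable.comp measurable_prodMk_left
  rw [Kernel.snd_apply' _ _ hB, Kernel.compProd_apply (measurable_snd hB)]
  exact Measure.bind_apply hB hm.aemeasurable

/-- Every exchangeable dissociated random semimetric is sampled from a qmm-space. -/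
theorem exists_qmmSpace {κ : ProbabilityMeasure MInfty}
    (hκ : IsExchangeableDissociated (κ : Measure MInfty)) : ∃ X : QMMSpace.{0}, X.tau = κ := by
  obtain ⟨ν, q, hν, hqM, hqs, hq⟩ := hκ.exists_entries
  let E := ℕ → unitInterval
  -- The law `q (x, x)` need not be the point mass at zero, and `ν` may have atoms. The label makes
  -- sampled points almost surely distinct, so forcing the value on equal labels does not affect the
  -- sampled law.
  let d : E × ℝ → E × ℝ → ProbabilityMeasure unitInterval := fun a b =>
    open Classical in if a.2 = b.2 then diracZero else ⟨q (a.1, b.1), inferInstance⟩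
  have hd : Measurable (Function.uncurry d) := by
    refine Measurable.ite (measurableSet_eq_fun (by fun_prop) (by fun_prop)) measurable_const ?_
    exact (q.measurable.comp (by fun_prop :
      Measurable fun a : (E × ℝ) × (E × ℝ) => (a.1.1, a.2.1))).subtype_mk
  have hlaw : entryLaw (ν.prod labelMeasure) d = (κ : Measure MInfty).map upperEntries := by
    have h1 : (Measure.infinitePi fun _ : ℕ => ν.prod labelMeasure).map (fun z i => (z i).1)
        = Measure.infinitePi fun _ : ℕ => ν := by
      rw [Measure.infinitePi_map_pi _ (fun _ => measurable_fst)]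
      simp [Measure.map_fst_prod]
    have h2 : (Measure.infinitePi fun _ : ℕ => ν.prod labelMeasure).map (fun z i => (z i).2)
        = labelSequence := by
      rw [Measure.infinitePi_map_pi _ (fun _ => measurable_snd)]
      simp [Measure.map_snd_prod]
    have hinj := Measure.ae_injective_infinitePi labelMeasure
    rw [← labelSequence, ← h2] at hinj
    have hm : Measurable fun x : ℕ → E =>
        Measure.infinitePi fun p : UpperPair => q (x p.1.1, x p.1.2) :=
      Measure.measurable_infinitePi fun p => q.measurable.comp
        (by fun_prop : Measurable fun x : ℕ → E => (x p.1.1, x p.1.2))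
    rw [← hq, ← h1, Measure.bind_map _ (by fun_prop) hm, entryLaw]
    refine Measure.bind_congr_right ?_
    have hsnd : Measurable fun (z : ℕ → E × ℝ) i => (z i).2 := by fun_prop
    filter_upwards [ae_of_ae_map hsnd.aemeasurable hinj] with z hz
    congr 1
    funext p
    have : (z p.1.1).2 ≠ (z p.1.2).2 := hz.ne p.2.ne
    simp [d, this]
  have htri := (entryLaw_triangle_iff (μ := ν.prod labelMeasure) hd measurableSet_triangleSet).1 (by
    rw [hlaw]
    refine (ae_map_iff measurable_upperEntries.aemeasurable ?_).2 ?_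
    · have : Measurable fun e : UpperPair → unitInterval =>
        (e ⟨(0, 1), by decide⟩, e ⟨(1, 2), by decide⟩, e ⟨(0, 2), by decide⟩) := by fun_prop
      exact this measurableSet_triangleSet
    · filter_upwards [hκ.ae_triangle] with x hx
      refine ⟨?_, ?_, hx 0 1 2⟩
      · have := hx 0 2 1
        rw [x.2.1 2 1] at this
        simpa [upperEntries, add_comm] using this
      · have := hx 1 0 2
        rw [x.2.1 1 0] at this
        simpa [upperEntries] using this)
  let X : QMMSpace.{0} :=
    { carrier := E × ℝ
      μ := ν.prod labelMeasure
      d := d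
      measurable_d := hd
      d_self := fun a => by simp [d]
      d_comm := fun a b => by simp [d, eq_comm (a := a.2), hqs a.1 b.1]
      triangle := htri }
  refine ⟨X, Subtype.ext ?_⟩
  refine X.coe_tau_eq_map_entryLaw.trans ?_
  change (entryLaw (ν.prod labelMeasure) d).map symmFill = κ
  rw [hlaw, Measure.map_map measurable_symmFill measurable_upperEntries]
  have : symmFill ∘ upperEntries = id := funext symmFill_upperEntries
  rw [this, Measure.map_id]

end IsExchangeableDissociated

theorem mainTheorem1 :
    (∀ κ ∈ chiBar, ∃ X : QMMSpace.{0}, X.tau = κ) ∧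
    (∀ X : QMMSpace.{u}, X.tau ∈ chiBar) := by
  exact ⟨fun _ hκ => (isExchangeableDissociated_of_mem_chiBar hκ).exists_qmmSpace,
    fun X => X.isExchangeableDissociated_tau.mem_chiBar⟩
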